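/- Let $q^{1/4}$ be an indeterminate and work over the field $\mathbb{Q}(q^{1/4})$. Put $[k]=\dfrac{q^{k/2}-q^{-k/2}}{q^{1/2}-q^{-1/2}}$, $(q;q)_k=\prod_{l=1}^{k}(1-q^l)$, and $\binom{n}{k}_q=\dfrac{(q;q)_n}{(q;q)_k(q;q)_{n-k}}$ for $0\le k\le n$. For a disk with $m$ marked points on its boundary let $W_m$ be the vector space with basis the boundary-fixing isotopy classes of crossingless systems of disjoint embedded arcs without closed components whose set of endpoints is exactly the set of marked points (for $m=0$, the only basis element is the empty disk $\emptyset$). The Kauffman bracket $\langle\,\cdot\,\rangle_2$ of a tangle diagram in the disk is the element of $W_m$ determined by two local rules: a trivial loop is replaced by the factor $-[2]$, and a crossing in which the strand from the upper left to the lower right is over equals $q^{1/4}$ times two horizontal strands plus $q^{-1/4}$ times two turnbacks (one arc joining the two left ends and one arc joining the two right ends). Webs are written with left and right marked points; gluing side by side and placing one above the other are extended bilinearly, closed loops being replaced by $-[2]$. The clasps (Jones--Wenzl projectors) $P_n\in W_{n+n}$ are defined as follows: $P_0$ is the empty web, $P_1$ is one strand, and for $n\ge 2$ $$P_n=(P_{n-1}\otimes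 1)+\frac{[n-1]}{[n]}\,(P_{n-1}\otimes 1)\,e_{n-1}\,(P_{n-1}\otimes 1),$$ where $\otimes$ places the first web above the second, and $e_{n-1}$ consists of $n-2$ horizontal strands at the top and, at the last two places, one turnback on the left and one on the right. Then for every integer $n\ge 0$: (1) Let $X_n$ be the crossing of two bundles of $n$ parallel strands, in which the bundle from the upper left to the lower right passes over the other, and for $0\le k\le n$ let $Y_{n,k}$ be the crossingless diagram with $n+n$ left and $n+n$ right ends which has $k$ horizontal strands at the top, $k$ horizontal strands at the bottom, and between them $n-k$ nested turnbacks on the left and $n-k$ nested turnbacks on the right. Then in $W_{4n}$ $$(P_n\otimes P_n)\,\langle X_n\rangle_2\,(P_n\otimes P_n)=\sum_{k=0}^{n}q^{\frac{-n^2+2k^2}{4}}\binom{n}{k}_q\,(P_n\otimes P_n)\,\langle Y_{n,k}\rangle_2\,(P_n\otimes P_n).$$ (2) The loop colored by $n$, that is, the closure of $P_n$ by $n$ parallel strands, equals $(-1)^n[n+1]\,\emptyset$ in $W_0$. -/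

import Mathlib

noncomputable section

namespace A1Web

/-! ### Scalars and quantum integers -/

/-- The field `ℚ(q^{1/4})` of rational functions in one variable `q^{1/4}`. -/
abbrev K : Type := RatFunc ℚ

/-- The variable `t = q^{1/4}`; thus `q^{j/4} = t ^ j` for every integer `j`. -/
def t : K := RatFunc.X

/-- `q = t ^ 4`. -/
def q : K := t ^ 4

/-- `{k} = q^{k/2} - q^{-k/2}`. -/
def qBrace (k : ℤ) : K := t ^ (2 * k) - t ^ (-(2 * k))

/-- The quantum integer `[k] = {k} / {1}`. -/
def qInt (k : ℤ) : K := qBrace k / qBrace 1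

/-- The `q`-Pochhammer symbol `(q; q)_k = ∏_{l=1}^k (1 - q^l)`. -/
def qPoch (k : ℕ) : K := ∏ l ∈ Finset.Icc 1 k, (1 - q ^ l)

/-- The `q`-binomial coefficient `(q;q)_n / ((q;q)_k (q;q)_{n-k})`, and `0` for `k > n`. -/
def qBinom (n k : ℕ) : K :=
  if k ≤ n then qPoch n / (qPoch k * qPoch (n - k)) else 0

/-! ### Basis webs

The disk is drawn as a rectangle with `m` marked points on its left side and `n` marked points on
its right side, each side numbered from top to bottom. -/

/-- The place of a marked point when the boundary of the disk is traversed counterclockwise from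
its upper left corner: down the left side, then up the right side. -/
def bdryPos {m n : ℕ} : Fin m ⊕ Fin n → ℕ
  | Sum.inl i => i
  | Sum.inr j => m + (n - 1 - j)

/-- An `A₁` basis web on the disk with `m` left and `n` right marked points. A boundary-fixing
isotopy class of disjoint embedded arcs with these endpoints is the same as a way of pairing the
marked points such that no two pairs interleave on the boundary circle. The arc at `x` ends
at `partner x`. -/
@[ext]
structure BasisWeb (m n : ℕ) where
  partner : Fin m ⊕ Fin n → Fin m ⊕ Fin n
  partner_partner : ∀ x, partner (partner x) = x
  partner_ne : ∀ x, partner x ≠ x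
  noncrossing : ∀ x y, ¬ (bdryPos x < bdryPos y ∧ bdryPos y < bdryPos (partner x) ∧
    bdryPos (partner x) < bdryPos (partner y))

instance (m n : ℕ) : Finite (BasisWeb m n) :=
  Finite.of_injective BasisWeb.partner fun _ _ h => BasisWeb.ext h

/-- The `A₁` web space: the `ℚ(q^{1/4})`-vector space with basis the basis webs. -/
abbrev W (m n : ℕ) : Type := BasisWeb m n →₀ K

/-- `n` parallel horizontal strands. (The two sides may carry two expressions `m`, `n` for the
same number.) -/
def strandsWeb {m n : ℕ} (h : m = n) : BasisWeb m n where
  partner := Sum.elim (fun i => Sum.inr (Fin.cast h i)) (fun j => Sum.inl (Fin.cast h.symm j))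
  partner_partner := by rintro (i | j) <;> simp
  partner_ne := by rintro (i | j) <;> simp
  noncrossing := by
    subst h
    rintro (i | i) (j | j) <;> simp [bdryPos] <;> omega

/-- A single arc with both ends on the right side. -/
def cupWeb : BasisWeb 0 2 where
  partner := Sum.map id Fin.rev
  partner_partner := by rintro (i | j) <;> simp
  partner_ne := by decide
  noncrossing := by
    rintro (i | i) (j | j)
    · exact i.elim0
    · exact i.elim0
    · exact j.elim0
    · simp [bdryPos]; omega

/-- A single arc with both ends on the left side. -/
def capWeb : BasisWeb 2 0 where
  partner := Sum.map Fin.rev id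
  partner_partner := by rintro (i | j) <;> simp
  partner_ne := by decide
  noncrossing := by
    rintro (i | i) (j | j)
    · simp [bdryPos]; omega
    · exact j.elim0
    · exact i.elim0
    · exact i.elim0

/-! ### Placing webs on top of each other -/

/-- The marked points of two disks, the first placed above the second. -/
def stackEquiv (m n m' n' : ℕ) :
    (Fin m ⊕ Fin n) ⊕ (Fin m' ⊕ Fin n') ≃ Fin (m + m') ⊕ Fin (n + n') :=
  (Equiv.sumSumSumComm _ _ _ _).trans (Equiv.sumCongr finSumFinEquiv finSumFinEquiv)

/-- The disjoint union of `w` and `v`, with `w` above `v`. -/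
def stackWeb {m n m' n' : ℕ} (w : BasisWeb m n) (v : BasisWeb m' n') :
    BasisWeb (m + m') (n + n') where
  partner := fun x =>
    stackEquiv m n m' n' (Sum.map w.partner v.partner ((stackEquiv m n m' n').symm x))
  partner_partner := by
    intro x
    obtain ⟨x, rfl⟩ := (stackEquiv m n m' n').surjective x
    rcases x with x | x <;> simp [w.partner_partner, v.partner_partner]
  partner_ne := by
    intro x
    obtain ⟨x, rfl⟩ := (stackEquiv m n m' n').surjective x
    rcases x with x | x <;> simp [w.partner_ne, v.partner_ne]
  noncrossing := by
    intro x y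
    obtain ⟨x, rfl⟩ := (stackEquiv m n m' n').surjective x
    obtain ⟨y, rfl⟩ := (stackEquiv m n m' n').surjective y
    have up : ∀ z : Fin m ⊕ Fin n,
        (bdryPos z < m ∧ bdryPos (stackEquiv m n m' n' (Sum.inl z)) = bdryPos z) ∨
        (m ≤ bdryPos z ∧ bdryPos (stackEquiv m n m' n' (Sum.inl z)) = bdryPos z + m' + n') := by
      rintro (i | j) <;> simp [stackEquiv, bdryPos] <;> omega
    have down : ∀ z : Fin m' ⊕ Fin n',
        bdryPos z < m' + n' ∧ bdryPos (stackEquiv m n m' n' (Sum.inr z)) = bdryPos z + m := by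
      rintro (i | j) <;> simp [stackEquiv, bdryPos] <;> omega
    rcases x with x | x <;> rcases y with y | y <;> simp only [Equiv.symm_apply_apply, Sum.map_inl,
      Sum.map_inr]
    · have := w.noncrossing x y
      have := up x; have := up y; have := up (w.partner x); have := up (w.partner y)
      omega
    · have := up x; have := down y; have := up (w.partner x); have := down (v.partner y)
      omega
    · have := down x; have := up y; have := down (v.partner x); have := up (w.partner y)
      omega
    · have := v.noncrossing x y
      have := down x; have := down y; have := down (v.partner x); have := down (v.partner y)
      omega

/-- Bilinear extension of `stackWeb` to web spaces. -/
def stack {m n m' n' : ℕ} : W m n →ₗ[K] W m' n' →ₗ[K] W (m + m') (n + n') :=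
  Finsupp.lift _ K _ fun w => Finsupp.lift _ K _ fun v => Finsupp.single (stackWeb w v) 1

/-! ### Gluing webs side by side -/

/-- Two marked points of the glued disk are joined by an arc of the left web `w` or of the right
web `v`. The points of the glued disk are `Fin a` (left side), `Fin b` (the common side) and
`Fin c` (right side). -/
inductive Joined {a b c : ℕ} (w : BasisWeb a b) (v : BasisWeb b c) :
    Fin a ⊕ Fin b ⊕ Fin c → Fin a ⊕ Fin b ⊕ Fin c → Prop
  | left (x : Fin a ⊕ Fin b) :
      Joined w v (Sum.map id Sum.inl x) (Sum.map id Sum.inl (w.partner x))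
  | right (x : Fin b ⊕ Fin c) : Joined w v (Sum.inr x) (Sum.inr (v.partner x))

/-- Lying on the same curve of the glued picture. -/
def curveSetoid {a b c : ℕ} (w : BasisWeb a b) (v : BasisWeb b c) :
    Setoid (Fin a ⊕ Fin b ⊕ Fin c) :=
  Relation.EqvGen.setoid (Joined w v)

/-- The outer points of the glued disk among all its points. -/
def outer {a b c : ℕ} : Fin a ⊕ Fin c → Fin a ⊕ Fin b ⊕ Fin c :=
  Sum.map id Sum.inr

/-- The number of closed loops of the glued picture: the curves without outer points. -/
def loopCount {a b c : ℕ} (w : BasisWeb a b) (v : BasisWeb b c) : ℕ :=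
  Nat.card {C : Quotient (curveSetoid w v) //
    ∀ x : Fin a ⊕ Fin c, Quotient.mk (curveSetoid w v) (outer x) ≠ C}

/-- `u` consists of the arcs of the glued picture: two different outer points are joined in `u`
exactly if they lie on the same curve. -/
def IsGluing {a b c : ℕ} (w : BasisWeb a b) (v : BasisWeb b c) (u : BasisWeb a c) : Prop :=
  ∀ x y, u.partner x = y ↔ x ≠ y ∧ curveSetoid w v (outer x) (outer y)

open Classical in
/-- The web obtained from `w` (left) and `v` (right) by gluing along the common side and replacing
each closed loop by the factor `-[2]`. -/
def glueWeb {a b c : ℕ} (w : BasisWeb a b) (v : BasisWeb b c) : W a c :=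
  Finsupp.equivFunOnFinite.symm fun u =>
    if IsGluing w v u then (-qInt 2) ^ loopCount w v else 0

/-- Bilinear extension of `glueWeb` to web spaces; `glue x y` has `x` on the left and `y` on the
right. -/
def glue {a b c : ℕ} : W a b →ₗ[K] W b c →ₗ[K] W a c :=
  Finsupp.lift _ K _ fun w => Finsupp.lift _ K _ fun v => glueWeb w v

/-! ### Tangle diagrams and the Kauffman bracket -/

/-- Tangle diagrams on the disk with `m` left and `n` right marked points, cut into elementary
pieces by horizontal and vertical lines. -/
inductive Tangle : ℕ → ℕ → Type
  /-- parallel horizontal strands -/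
  | strands {m n : ℕ} (h : m = n) : Tangle m n
  /-- one arc with both ends on the right side -/
  | cup : Tangle 0 2
  /-- one arc with both ends on the left side -/
  | cap : Tangle 2 0
  /-- a crossing; the strand from upper left to lower right is over -/
  | overDown : Tangle 2 2
  /-- a crossing; the strand from lower left to upper right is over -/
  | overUp : Tangle 2 2
  /-- the first diagram to the left of the second -/
  | hcomp {a b c : ℕ} (D : Tangle a b) (E : Tangle b c) : Tangle a c
  /-- the first diagram above the second -/
  | vcomp {m n m' n' : ℕ} (D : Tangle m n) (E : Tangle m' n') : Tangle (m + m') (n + n')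

/-- Two horizontal strands. -/
def horizontalWeb : BasisWeb 2 2 := strandsWeb rfl

/-- Two turnbacks: an arc joining the left points and an arc joining the right points. -/
def turnWeb : BasisWeb 2 2 := stackWeb capWeb cupWeb

/-- The Kauffman bracket. The skein relation smooths a crossing into `q^{1/4}` times the smoothing
joining the regions swept out when the over strand is turned counterclockwise, plus `q^{-1/4}`
times the other one; a trivial loop is `-[2]` by the definition of `glue`. -/
def bracket : {m n : ℕ} → Tangle m n → W m n
  | _, _, .strands h => Finsupp.single (strandsWeb h) 1
  | _, _, .cup => Finsupp.single cupWeb 1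
  | _, _, .cap => Finsupp.single capWeb 1
  | _, _, .overDown =>
      t • Finsupp.single horizontalWeb 1 + t⁻¹ • Finsupp.single turnWeb 1
  | _, _, .overUp =>
      t • Finsupp.single turnWeb 1 + t⁻¹ • Finsupp.single horizontalWeb 1
  | _, _, .hcomp D E => glue (bracket D) (bracket E)
  | _, _, .vcomp D E => stack (bracket D) (bracket E)

/-- `n` parallel strands. -/
def strands (n : ℕ) : Tangle n n := .strands rfl

/-- `n` parallel (nested) arcs with all ends on the right side. -/
def cups : (n : ℕ) → Tangle 0 (n + n)
  | 0 => .strands rfl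
  | n + 1 => ((cups n).hcomp (((strands n).vcomp .cup).vcomp (strands n))).hcomp
      (.strands (by omega : n + 2 + n = (n + 1) + (n + 1)))

/-- `n` parallel (nested) arcs with all ends on the left side. -/
def caps : (n : ℕ) → Tangle (n + n) 0
  | 0 => .strands rfl
  | n + 1 => (Tangle.strands (by omega : (n + 1) + (n + 1) = n + 2 + n)).hcomp
      ((((strands n).vcomp .cap).vcomp (strands n)).hcomp (caps n))

/-- `k` parallel strands from upper left to lower right, crossing over one strand from lower left
to upper right. -/
def crossOne : (k : ℕ) → Tangle (k + 1) (1 + k)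
  | 0 => strands 1
  | k + 1 => ((strands k).vcomp .overDown).hcomp ((crossOne k).vcomp (strands 1))

/-- A crossing with decorated strands: `k` parallel strands from upper left to lower right, crossing
over `l` parallel strands from lower left to upper right. -/
def cross (k : ℕ) : (l : ℕ) → Tangle (k + l) (l + k)
  | 0 => .strands (by omega)
  | l + 1 => (((cross k l).vcomp (strands 1)).hcomp ((strands l).vcomp (crossOne k))).hcomp
      (.strands (by omega : l + (1 + k) = (l + 1) + k))

/-- `k` through strands at the top, `k` through strands at the bottom, and between them `n - k`
nested turnbacks on the left and `n - k` nested turnbacks on the right. -/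
def turnback (n : ℕ) (k : Fin (n + 1)) : Tangle (n + n) (n + n) :=
  ((Tangle.strands (by omega : n + n = k + ((n - k) + (n - k)) + k)).hcomp
    (((strands k).vcomp ((caps (n - k)).hcomp (cups (n - k)))).vcomp (strands k))).hcomp
    (.strands (by omega))

/-! ### Clasps -/

/-- The `A₁` clasp (Jones-Wenzl projector) on `n` strands; for `n = 0` it is the empty web. -/
def clasp : (n : ℕ) → W n n
  | 0 => bracket (strands 0)
  | 1 => bracket (strands 1)
  | n + 2 =>
      let p : W (n + 2) (n + 2) := stack (clasp (n + 1)) (bracket (strands 1))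
      p + (qInt (n + 1) / qInt (n + 2)) •
        glue (glue p (bracket ((strands n).vcomp (Tangle.cap.hcomp .cup)))) p

/-- The clasped web of a tangle diagram with `n + n` left and `n + n` right ends: each of the four
groups of `n` ends goes through a clasp. -/
def clasped (n : ℕ) (D : Tangle (n + n) (n + n)) : W (n + n) (n + n) :=
  glue (glue (stack (clasp n) (clasp n)) (bracket D)) (stack (clasp n) (clasp n))

/-- The closed loop colored by `n`, carrying one clasp. -/
def coloredLoop (n : ℕ) : W 0 0 :=
  glue (glue (bracket (cups n)) (stack (clasp n) (bracket (strands n)))) (bracket (caps n))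

/-- The empty disk, as an element of the web space without marked points. -/
def emptyDisk : W 0 0 := Finsupp.single (strandsWeb rfl) 1

end A1Web

end

/-!
Label the marked points of a disk by two states. A web acts on labels by the incidence matrix of
"constant along the arcs", and when two webs are glued, the product of their matrices counts
labelings constant along the curves of the glued picture: it is `2 ^ loops` times the matrix of the
glued web, and the matrix of a web determines the web. Associativity of gluing and its
compatibility with stacking are thereby reduced to those of matrix products. That the glued picture
is again planar follows from a parity count: two chords cross exactly if an alternating bilinear
form over `ZMod 2` does not vanish on their ends. For two disjoint sets of curves of a glued picture
it is the sum of its values on the two glued webs, the contributions of the common side cancelling.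

Webs with `N` points on either side then form an algebra, generated by the turnbacks `e i` subject
to the Temperley--Lieb relations, in which every crossing is `t + t⁻¹ e i`. Resolving a crossing of
two bundles row by row between two pairs of clasps, every turnback that is not at the boundary
between the bundles is killed by a clasp, and the coefficients of the surviving words satisfy the
Pascal recursion of the `q`-binomial coefficients. The colored loop is computed by closing one
strand at a time, each closure of the Jones--Wenzl projector on `k + 1` strands contributing the
factor `-[k + 2] / [k + 1]`.
-/

noncomputable section

namespace A1Web

open Finset.HasAntidiagonal (antidiagonal)

/-! ### Curves of a glued picture -/

section Dihedral

open MulAction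

theorem dvd_two_mul_or_dvd_two_mul_sub_one_iff {s k : ℤ} (hs : 0 < s) (hk : ¬ s ∣ k) :
    s ∣ 2 * k - 1 ∨ s ∣ 2 * k ↔ s ∣ k - (s + 1) / 2 := by
  obtain ⟨c, r, hr, hrs, rfl⟩ : ∃ c r, 0 < r ∧ r < s ∧ k = r + s * c := by
    refine ⟨k / s, k % s, ?_, Int.emod_lt_of_pos k hs, (Int.emod_add_mul_ediv k s).symm⟩
    exact (Int.emod_nonneg k hs.ne').lt_of_ne' fun h => hk (Int.dvd_of_emod_eq_zero h)
  rw [show 2 * (r + s * c) - 1 = 2 * r - 1 + s * (2 * c) by ring,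
    show 2 * (r + s * c) = 2 * r + s * (2 * c) by ring,
    show r + s * c - (s + 1) / 2 = r - (s + 1) / 2 + s * c by ring,
    dvd_add_left (dvd_mul_right s _), dvd_add_left (dvd_mul_right s _),
    dvd_add_left (dvd_mul_right s _)]
  constructor
  · rintro (⟨d, hd⟩ | ⟨d, hd⟩) <;>
    · obtain rfl : d = 1 := by nlinarith
      exact ⟨0, by omega⟩
  · intro h
    have := Int.eq_zero_of_abs_lt_dvd h (by rw [abs_lt]; omega)
    rcases Int.emod_two_eq_zero_or_one s with hs2 | hs2
    · exact .inr ⟨1, by omega⟩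
    · exact .inl ⟨1, by omega⟩

variable {X : Type*} {α β : Equiv.Perm X} {x : X}

theorem apply_zpow_mul_apply (hα : α * α = 1) (hβ : β * β = 1) (hx : β x = x) (k : ℤ) :
    β (((α * β) ^ k) x) = ((α * β) ^ (-k)) x := by
  have hconj : SemiconjBy β (α * β) (α * β)⁻¹ := by
    rw [SemiconjBy, mul_inv_rev, inv_eq_of_mul_eq_one_left hα, inv_eq_of_mul_eq_one_left hβ,
      mul_assoc]
  rw [zpow_neg, ← inv_zpow, ← Equiv.Perm.mul_apply, hconj.zpow_right k, Equiv.Perm.mul_apply, hx]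

theorem apply_zpow_mul_apply' (hα : α * α = 1) (hβ : β * β = 1) (hx : β x = x) (k : ℤ) :
    α (((α * β) ^ k) x) = ((α * β) ^ (1 - k)) x := by
  rw [sub_eq_add_neg, zpow_one_add, Equiv.Perm.mul_apply, ← apply_zpow_mul_apply hα hβ hx,
    ← Equiv.Perm.mul_apply (α * β), mul_assoc α β β, hβ, mul_one]

theorem eqvGen_iff_exists_zpow (hα : α * α = 1) (hβ : β * β = 1) (hx : β x = x) (y : X) :
    Relation.EqvGen (fun y z => z = α y ∨ z = β y) x y ↔ ∃ k : ℤ, ((α * β) ^ k) x = y := by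
  have hαβ (z : X) : Relation.EqvGen (fun y z => z = α y ∨ z = β y) z ((α * β) z) :=
    .trans _ _ _ (.rel _ _ (.inr rfl)) (.rel _ _ (.inl rfl))
  constructor
  · suffices h : Relation.EqvGen.setoid (fun y z => z = α y ∨ z = β y) ≤
        Setoid.ker fun y => ∃ k : ℤ, ((α * β) ^ k) x = y from
      fun hxy => ((h hxy).mp ⟨0, rfl⟩ :)
    refine Setoid.eqvGen_le ?_
    rintro y _ (rfl | rfl) <;> refine propext ⟨?_, ?_⟩ <;> rintro ⟨k, hk⟩
    · exact ⟨1 - k, by rw [← hk, apply_zpow_mul_apply' hα hβ hx]⟩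
    · refine ⟨1 - k, α.injective ?_⟩
      rw [apply_zpow_mul_apply' hα hβ hx, sub_sub_cancel, hk]
    · exact ⟨-k, by rw [← hk, apply_zpow_mul_apply hα hβ hx]⟩
    · refine ⟨-k, β.injective ?_⟩
      rw [apply_zpow_mul_apply hα hβ hx, neg_neg, hk]
  · rintro ⟨k, rfl⟩
    induction k with
    | zero => exact .refl _
    | succ i ih =>
      rw [add_comm, zpow_one_add]
      exact .trans _ _ _ ih (hαβ _)
    | pred i ih =>
      refine .trans _ _ _ ih (.symm _ _ ?_)
      have h := hαβ (((α * β) ^ (-(i : ℤ) - 1)) x)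
      rwa [← Equiv.Perm.mul_apply, ← zpow_one_add, add_sub_cancel] at h

/-- A finite dihedral orbit through a fixed point of one reflection is a path, and a path has
exactly two ends. -/
theorem existsUnique_fixedPoint_ne [Finite X] (hα : α * α = 1) (hβ : β * β = 1)
    (hαβ : ∀ y, ¬ (α y = y ∧ β y = y)) (hx : β x = x) :
    ∃! y, y ≠ x ∧ Relation.EqvGen (fun y z => z = α y ∨ z = β y) x y ∧ (α y = y ∨ β y = y) := by
  set s := (period (α * β) x : ℤ)
  have eq_iff (k l : ℤ) : ((α * β) ^ k) x = ((α * β) ^ l) x ↔ s ∣ k - l := by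
    rw [← zpow_smul_eq_iff_period_dvd, sub_eq_neg_add, zpow_add, zpow_neg, Equiv.Perm.smul_def,
      Equiv.Perm.mul_apply, Equiv.Perm.inv_eq_iff_eq]
  have eq_self_iff (k : ℤ) : ((α * β) ^ k) x = x ↔ s ∣ k := by
    simpa using eq_iff k 0
  have fixed_iff (k : ℤ) : (α (((α * β) ^ k) x) = ((α * β) ^ k) x ∨
      β (((α * β) ^ k) x) = ((α * β) ^ k) x) ↔ s ∣ 2 * k - 1 ∨ s ∣ 2 * k := by
    rw [apply_zpow_mul_apply hα hβ hx, apply_zpow_mul_apply' hα hβ hx, eq_iff, eq_iff, ← dvd_neg,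
      ← dvd_neg (b := -k - k)]
    ring_nf
  have hs : 0 < s := Int.natCast_pos.2 <|
    period_pos_of_fixed (orderOf_pos (α * β)) (by rw [pow_orderOf_eq_one, one_smul])
  have hs_ne : s ≠ 1 := fun h => hαβ x ⟨by
    have h1 := (eq_self_iff 1).2 (h ▸ dvd_rfl)
    rwa [zpow_one, Equiv.Perm.mul_apply, hx] at h1, hx⟩
  have not_dvd : ¬ s ∣ (s + 1) / 2 := fun h => by
    have := Int.le_of_dvd (by omega) h
    omega
  refine ⟨((α * β) ^ ((s + 1) / 2)) x, ⟨?_, ?_, ?_⟩, ?_⟩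
  · rwa [Ne, eq_self_iff]
  · exact (eqvGen_iff_exists_zpow hα hβ hx _).2 ⟨_, rfl⟩
  · rw [fixed_iff, dvd_two_mul_or_dvd_two_mul_sub_one_iff hs not_dvd, sub_self]
    exact dvd_zero s
  · rintro y ⟨hyx, hxy, hy⟩
    obtain ⟨k, rfl⟩ := (eqvGen_iff_exists_zpow hα hβ hx y).1 hxy
    rw [Ne, eq_self_iff] at hyx
    rwa [fixed_iff, dvd_two_mul_or_dvd_two_mul_sub_one_iff hs hyx, ← eq_iff] at hy

end Dihedral

section Curves

variable {a b c : ℕ} (w : BasisWeb a b) (v : BasisWeb b c)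

/-- The pairing of the marked points of a basis web, as a permutation. -/
def BasisWeb.perm {m n : ℕ} (w : BasisWeb m n) : Equiv.Perm (Fin m ⊕ Fin n) :=
  Function.Involutive.toPerm w.partner w.partner_partner

theorem BasisWeb.perm_mul_perm {m n : ℕ} (w : BasisWeb m n) : w.perm * w.perm = 1 :=
  Equiv.ext w.partner_partner

/-- Following the arcs of the left web of a glued picture, which fixes the right side. -/
def leftMove : Equiv.Perm (Fin a ⊕ Fin b ⊕ Fin c) :=
  (Equiv.sumAssoc _ _ _).permCongr (Equiv.Perm.sumCongr w.perm 1)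

/-- Following the arcs of the right web of a glued picture, which fixes the left side. -/
def rightMove : Equiv.Perm (Fin a ⊕ Fin b ⊕ Fin c) :=
  Equiv.Perm.sumCongr 1 v.perm

theorem leftMove_map (x : Fin a ⊕ Fin b) :
    leftMove (c := c) w (Sum.map id Sum.inl x) = Sum.map id Sum.inl (w.partner x) := by
  rcases x with i | j
  · change Equiv.sumAssoc _ _ _ (Sum.inl (w.partner (Sum.inl i))) = _
    cases w.partner (Sum.inl i) <;> rfl
  · change Equiv.sumAssoc _ _ _ (Sum.inl (w.partner (Sum.inr j))) = _
    cases w.partner (Sum.inr j) <;> rfl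

theorem leftMove_mul_leftMove : leftMove (c := c) w * leftMove w = 1 := by
  rw [leftMove, ← Equiv.permCongr_mul, Equiv.Perm.sumCongr_mul, w.perm_mul_perm, one_mul,
    Equiv.Perm.sumCongr_one]
  exact Equiv.permCongr_refl _

theorem rightMove_mul_rightMove : rightMove (a := a) v * rightMove v = 1 := by
  rw [rightMove, Equiv.Perm.sumCongr_mul, v.perm_mul_perm, one_mul, Equiv.Perm.sumCongr_one]

theorem leftMove_eq_self_iff (x : Fin a ⊕ Fin b ⊕ Fin c) :
    leftMove w x = x ↔ ∃ k, x = Sum.inr (Sum.inr k) := by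
  have hne (y : Fin a ⊕ Fin b) :
      leftMove (c := c) w (Sum.map id Sum.inl y) ≠ Sum.map id Sum.inl y := by
    rw [leftMove_map]
    exact (Sum.map_injective.2 ⟨Function.injective_id, Sum.inl_injective⟩).ne (w.partner_ne y)
  rcases x with i | j | k
  · exact iff_of_false (hne (Sum.inl i)) (by simp)
  · exact iff_of_false (hne (Sum.inr j)) (by simp)
  · exact iff_of_true rfl ⟨k, rfl⟩

theorem rightMove_eq_self_iff (x : Fin a ⊕ Fin b ⊕ Fin c) :
    rightMove v x = x ↔ ∃ i, x = Sum.inl i := by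
  rcases x with i | x
  · exact iff_of_true rfl ⟨i, rfl⟩
  · exact iff_of_false (fun h => v.partner_ne x (Sum.inr_injective h)) (by simp)

theorem curveSetoid_eq :
    curveSetoid w v = Relation.EqvGen.setoid fun x y => y = leftMove w x ∨ y = rightMove v x := by
  refine le_antisymm (Setoid.eqvGen_le ?_) (Setoid.eqvGen_le ?_)
  · rintro _ _ (x | x)
    · exact .rel _ _ (.inl (leftMove_map w x).symm)
    · exact .rel _ _ (.inr rfl)
  · rintro x _ (rfl | rfl)
    · rcases x with i | j | k
      · exact leftMove_map w (Sum.inl i) ▸ .rel _ _ (.left (Sum.inl i))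
      · exact leftMove_map w (Sum.inr j) ▸ .rel _ _ (.left (Sum.inr j))
      · exact .refl _
    · rcases x with i | x
      · exact .refl _
      · exact .rel _ _ (.right x)

theorem outer_injective : Function.Injective (outer : Fin a ⊕ Fin c → Fin a ⊕ Fin b ⊕ Fin c) :=
  Sum.map_injective.2 ⟨Function.injective_id, Sum.inr_injective⟩

theorem leftMove_or_rightMove_eq_self_iff (x : Fin a ⊕ Fin b ⊕ Fin c) :
    (leftMove w x = x ∨ rightMove v x = x) ↔ ∃ o, outer o = x := by
  rw [leftMove_eq_self_iff, rightMove_eq_self_iff, Sum.exists, or_comm]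
  simp only [outer, Sum.map_inl, Sum.map_inr, id_eq, eq_comm]

theorem existsUnique_curveSetoid_outer (x : Fin a ⊕ Fin c) :
    ∃! y, y ≠ x ∧ curveSetoid w v (outer x) (outer y) := by
  have hfix (z) : ¬ (leftMove w z = z ∧ rightMove v z = z) := by
    rw [leftMove_eq_self_iff, rightMove_eq_self_iff]
    rintro ⟨⟨k, rfl⟩, i, h⟩
    cases h
  obtain ⟨z, ⟨hzx, hxz, hz⟩, huniq⟩ : ∃! z, z ≠ outer x ∧ curveSetoid w v (outer x) z ∧
      (leftMove w z = z ∨ rightMove v z = z) := by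
    rw [curveSetoid_eq]
    rcases x with i | k
    · exact existsUnique_fixedPoint_ne (leftMove_mul_leftMove w) (rightMove_mul_rightMove v)
        hfix rfl
    · have h := existsUnique_fixedPoint_ne (rightMove_mul_rightMove v) (leftMove_mul_leftMove w)
        (fun z hz => hfix z hz.symm) (x := outer (Sum.inr k)) rfl
      simpa only [or_comm, Relation.EqvGen.setoid] using! h
  obtain ⟨y, rfl⟩ := (leftMove_or_rightMove_eq_self_iff w v z).1 hz
  refine ⟨y, ⟨ne_of_apply_ne outer hzx, hxz⟩, ?_⟩
  rintro y' ⟨hyx', hxy'⟩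
  exact outer_injective <| huniq _
    ⟨outer_injective.ne hyx', hxy', (leftMove_or_rightMove_eq_self_iff w v _).2 ⟨y', rfl⟩⟩

end Curves

/-! ### Planarity of gluings -/

section Linking

variable {m n : ℕ}

theorem bdryPos_injective : Function.Injective (bdryPos : Fin m ⊕ Fin n → ℕ) := by
  rintro (i | i) (j | j) h <;> simp only [bdryPos] at h <;> grind

/-- The bilinear form over `ZMod 2` whose value at the indicators of two sets `A` and `B` of marked
points is the parity of the number of pairs in `A × B` in boundary order. For `A` and `B` the sets
of ends of two arcs it detects whether the arcs cross. -/
def linking : LinearMap.BilinForm (ZMod 2) (Fin m ⊕ Fin n → ZMod 2) :=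
  Matrix.toBilin' (.of fun x y => if bdryPos x < bdryPos y then 1 else 0)

theorem linking_apply (f g : Fin m ⊕ Fin n → ZMod 2) :
    linking f g = ∑ x, ∑ y, f x * (if bdryPos x < bdryPos y then 1 else 0) * g y :=
  Matrix.toBilin'_apply _ f g

theorem linking_single_add_single {x x' y y' : Fin m ⊕ Fin n} (hxy : bdryPos x < bdryPos y)
    (hyx' : bdryPos y < bdryPos x') (hx'y' : bdryPos x' < bdryPos y') :
    linking (Pi.single x 1 + Pi.single x' 1) (Pi.single y 1 + Pi.single y' 1) = 1 := by
  simp only [linking, map_add, LinearMap.add_apply, Matrix.toBilin'_single, Matrix.of_apply,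
    if_pos hxy, if_pos hx'y', if_pos (hxy.trans (hyx'.trans hx'y')), if_neg hyx'.not_gt]
  decide

theorem linking_eq_add (f g : Fin m ⊕ Fin n → ZMod 2) :
    linking f g =
      (∑ i, ∑ j, f (Sum.inl i) * (if i < j then 1 else 0) * g (Sum.inl j)) +
      (∑ i, f (Sum.inl i)) * (∑ j, g (Sum.inr j)) +
      ∑ i, ∑ j, f (Sum.inr i) * (if j < i then 1 else 0) * g (Sum.inr j) := by
  have hlr (i : Fin m) (j : Fin n) : i.val < m + (n - 1 - j) := by omega
  have hrl (i : Fin m) (j : Fin n) : ¬ m + (n - 1 - j) < i := by omega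
  have hrr (i j : Fin n) : m + (n - 1 - i) < m + (n - 1 - j) ↔ j < i := by omega
  simp only [linking_apply, Fintype.sum_sum_type, bdryPos, hlr, hrl, hrr, Fin.val_fin_lt, if_true,
    if_false, mul_one, mul_zero, zero_mul, Finset.sum_const_zero, Finset.sum_add_distrib,
    Finset.sum_mul_sum]
  ring

theorem sum_sum_lt_add_sum_sum_gt {ι R : Type*} [Fintype ι] [LinearOrder ι] [CommSemiring R]
    {f g : ι → R} (h : ∀ i, f i * g i = 0) :
    (∑ i, ∑ j, f i * (if i < j then 1 else 0) * g j) +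
      (∑ i, ∑ j, f i * (if j < i then 1 else 0) * g j) = (∑ i, f i) * ∑ j, g j := by
  simp_rw [Finset.sum_mul_sum, ← Finset.sum_add_distrib]
  refine Finset.sum_congr rfl fun i _ => Finset.sum_congr rfl fun j _ => ?_
  rcases lt_trichotomy i j with hij | rfl | hij
  · simp [hij, hij.not_gt]
  · simp [h]
  · simp [hij, hij.not_gt]

end Linking

namespace BasisWeb

variable {m n : ℕ} (w : BasisWeb m n)

theorem sum_eq_zero_of_add_partner {M : Type*} [AddCommMonoid M] {f : Fin m ⊕ Fin n → M}
    (hf : ∀ x, f x + f (w.partner x) = 0) : ∑ x, f x = 0 :=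
  Finset.sum_involution (fun x _ => w.partner x) (fun x _ => hf x) (fun x _ _ => w.partner_ne x)
    (fun _ _ => Finset.mem_univ _) (fun x _ => w.partner_partner x)

theorem sum_eq_zero_of_partner_eq {R : Type*} [Semiring R] [CharP R 2] {f : Fin m ⊕ Fin n → R}
    (hf : ∀ x, f (w.partner x) = f x) : ∑ x, f x = 0 :=
  w.sum_eq_zero_of_add_partner fun x => by rw [hf, CharTwo.add_self_eq_zero]

theorem sum_bdryPos_lt_partner_eq_zero {x y : Fin m ⊕ Fin n} (hxy : x ≠ y)
    (hxy' : x ≠ w.partner y) :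
    ((if bdryPos x < bdryPos y then 1 else 0) +
      if bdryPos (w.partner x) < bdryPos y then 1 else 0) +
    ((if bdryPos x < bdryPos (w.partner y) then 1 else 0) +
      if bdryPos (w.partner x) < bdryPos (w.partner y) then 1 else 0) = (0 : ZMod 2) := by
  have partner_inj : Function.Injective w.partner := w.perm.injective
  have h₁ := bdryPos_injective.ne hxy
  have h₂ := bdryPos_injective.ne hxy'
  have h₃ := bdryPos_injective.ne (partner_inj.ne hxy)
  have h₄ := bdryPos_injective.ne (partner_inj.ne hxy')
  rw [w.partner_partner] at h₄
  have n₁ := w.noncrossing x y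
  have n₂ := w.noncrossing x (w.partner y)
  have n₃ := w.noncrossing (w.partner x) y
  have n₄ := w.noncrossing (w.partner x) (w.partner y)
  have n₅ := w.noncrossing y x
  have n₆ := w.noncrossing y (w.partner x)
  have n₇ := w.noncrossing (w.partner y) x
  have n₈ := w.noncrossing (w.partner y) (w.partner x)
  simp only [w.partner_partner] at n₁ n₂ n₃ n₄ n₅ n₆ n₇ n₈
  grind

theorem linking_eq_zero {f g : Fin m ⊕ Fin n → ZMod 2} (hf : ∀ x, f (w.partner x) = f x)
    (hg : ∀ x, g (w.partner x) = g x) (hfg : ∀ x, f x * g x = 0) : linking f g = 0 := by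
  rw [linking_apply, Finset.sum_comm]
  refine w.sum_eq_zero_of_add_partner fun y => ?_
  rw [← Finset.sum_add_distrib]
  refine w.sum_eq_zero_of_add_partner fun x => ?_
  rw [hf, hg]
  by_cases h : f x * g y = 0
  · rcases mul_eq_zero.1 h with h | h <;> simp [h]
  · have := w.sum_bdryPos_lt_partner_eq_zero (x := x) (y := y)
      (fun e => h (e ▸ hfg x)) (fun e => h (by rw [← hg, ← e, hfg]))
    linear_combination f x * g y * this

end BasisWeb

section GluedWeb

variable {a b c : ℕ} (w : BasisWeb a b) (v : BasisWeb b c)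

theorem linking_comp_outer_eq_zero {f g : Fin a ⊕ Fin b ⊕ Fin c → ZMod 2}
    (hf : ∀ p q, curveSetoid w v p q → f p = f q) (hg : ∀ p q, curveSetoid w v p q → g p = g q)
    (hfg : ∀ p, f p * g p = 0) : linking (f ∘ outer) (g ∘ outer) = 0 := by
  have left (p) : curveSetoid w v (Sum.map id Sum.inl (w.partner p)) (Sum.map id Sum.inl p) :=
    .symm _ _ (.rel _ _ (.left p))
  have right (p) : curveSetoid w v (Sum.inr (v.partner p)) (Sum.inr p) :=
    .symm _ _ (.rel _ _ (.right p))
  have hw := w.linking_eq_zero (f := f ∘ Sum.map id Sum.inl) (g := g ∘ Sum.map id Sum.inl)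
    (fun p => hf _ _ (left p)) (fun p => hg _ _ (left p)) (fun p => hfg _)
  have hv := v.linking_eq_zero (f := f ∘ Sum.inr) (g := g ∘ Sum.inr)
    (fun p => hf _ _ (right p)) (fun p => hg _ _ (right p)) (fun p => hfg _)
  have hwf := w.sum_eq_zero_of_partner_eq (f := f ∘ Sum.map id Sum.inl) fun p => hf _ _ (left p)
  have hvg := v.sum_eq_zero_of_partner_eq (f := g ∘ Sum.inr) fun p => hg _ _ (right p)
  have hmid := sum_sum_lt_add_sum_sum_gt (f := fun j => f (Sum.inr (Sum.inl j)))
    (g := fun j => g (Sum.inr (Sum.inl j))) fun j => hfg _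
  rw [linking_eq_add] at hw hv ⊢
  rw [Fintype.sum_sum_type] at hwf hvg
  simp only [Function.comp_apply, Sum.map_inl, Sum.map_inr, id_eq, outer] at *
  linear_combination hw + hv - hmid
    + ((∑ j, g (Sum.inr (Sum.inr j))) - ∑ j, g (Sum.inr (Sum.inl j))) * hwf
    - (∑ j, f (Sum.inr (Sum.inl j))) * (∑ j, g (Sum.inr (Sum.inr j))) *
      CharTwo.two_eq_zero (R := ZMod 2)

/-- The other end of the curve through an outer point of a glued picture. -/
def otherEnd (x : Fin a ⊕ Fin c) : Fin a ⊕ Fin c :=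
  (existsUnique_curveSetoid_outer w v x).choose

theorem otherEnd_eq_iff {x y : Fin a ⊕ Fin c} :
    otherEnd w v x = y ↔ x ≠ y ∧ curveSetoid w v (outer x) (outer y) := by
  obtain ⟨⟨hne, hcurve⟩, huniq⟩ := (existsUnique_curveSetoid_outer w v x).choose_spec
  exact ⟨fun h => h ▸ ⟨hne.symm, hcurve⟩, fun ⟨hxy, h⟩ => (huniq y ⟨hxy.symm, h⟩).symm⟩

theorem curveSetoid_outer_iff {x y : Fin a ⊕ Fin c} :
    curveSetoid w v (outer x) (outer y) ↔ y = x ∨ y = otherEnd w v x := by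
  rw [eq_comm (b := otherEnd w v x), otherEnd_eq_iff]
  by_cases h : y = x
  · simp [h]
  · simp [h, Ne.symm h]

theorem otherEnd_noncrossing (x y : Fin a ⊕ Fin c) :
    ¬ (bdryPos x < bdryPos y ∧ bdryPos y < bdryPos (otherEnd w v x) ∧
      bdryPos (otherEnd w v x) < bdryPos (otherEnd w v y)) := by
  classical
  rintro ⟨hxy, hyx', hx'y'⟩
  let curve (o : Fin a ⊕ Fin c) (p : Fin a ⊕ Fin b ⊕ Fin c) : ZMod 2 :=
    if curveSetoid w v (outer o) p then 1 else 0
  have curve_congr (o p q) (h : curveSetoid w v p q) : curve o p = curve o q :=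
    if_congr ⟨fun hp => .trans _ _ _ hp h, fun hq => .trans _ _ _ hq (.symm _ _ h)⟩ rfl rfl
  have curve_comp_outer (o) : curve o ∘ outer = Pi.single o 1 + Pi.single (otherEnd w v o) 1 := by
    have hne : o ≠ otherEnd w v o := ((otherEnd_eq_iff w v).1 rfl).1
    funext o'
    simp only [curve, Function.comp_apply, curveSetoid_outer_iff, Pi.add_apply, Pi.single_apply]
    grind
  have curve_mul (p) : curve x p * curve y p = 0 := by
    simp only [curve, mul_ite, mul_one, mul_zero, ite_eq_right_iff, one_ne_zero, imp_false]
    intro hyp hxp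
    rcases (curveSetoid_outer_iff w v).1 (.trans _ _ _ hxp (.symm _ _ hyp)) with rfl | rfl
    · exact lt_irrefl _ hxy
    · exact lt_irrefl _ hyx'
  have h := linking_comp_outer_eq_zero w v (curve_congr x) (curve_congr y) curve_mul
  rw [curve_comp_outer, curve_comp_outer, linking_single_add_single hxy hyx' hx'y'] at h
  exact one_ne_zero h

/-- The gluing of two basis webs, without its closed loops. -/
def gluedWeb : BasisWeb a c where
  partner := otherEnd w v
  partner_partner x := by
    obtain ⟨hne, hcurve⟩ := (otherEnd_eq_iff w v (x := x)).1 rfl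
    exact (otherEnd_eq_iff w v).2 ⟨hne.symm, .symm _ _ hcurve⟩
  partner_ne _ := ((otherEnd_eq_iff w v).1 rfl).1.symm
  noncrossing := otherEnd_noncrossing w v

theorem isGluing_gluedWeb : IsGluing w v (gluedWeb w v) := fun _ _ => otherEnd_eq_iff w v

theorem isGluing_iff {u : BasisWeb a c} : IsGluing w v u ↔ gluedWeb w v = u := by
  refine ⟨fun h => ?_, fun h => h ▸ isGluing_gluedWeb w v⟩
  ext x : 2
  rw [isGluing_gluedWeb w v, ← h]

theorem glueWeb_eq_single :
    glueWeb w v = Finsupp.single (gluedWeb w v) ((-qInt 2) ^ loopCount w v) := by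
  classical
  ext u
  simp only [glueWeb, Finsupp.equivFunOnFinite_symm_apply_apply, isGluing_iff, Finsupp.single_apply]

end GluedWeb

/-! ### Labelings of webs -/

section Labelings

variable {m n : ℕ}

/-- The labels of the marked points of a disk, the left points being labelled by `x` and the right
points by `y`. Both sequences continue beyond the marked points, so that moving a web within a disk
shifts its labels. -/
def label (x y : ℕ → Bool) : Fin m ⊕ Fin n → Bool :=
  Sum.elim (fun i => x i) (fun j => y j)

/-- Constancy of labels along the arcs of a web. -/
def IsLabeling (w : BasisWeb m n) (x y : ℕ → Bool) : Prop :=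
  ∀ p, label x y (w.partner p) = label x y p

open Classical in
/-- The indicator of `IsLabeling`: the entries of the matrix by which a web acts on labels. -/
def weight (w : BasisWeb m n) (x y : ℕ → Bool) : ℕ := if IsLabeling w x y then 1 else 0

/-- Extension of finitely many labels to a sequence. -/
def pad (y : Fin n → Bool) (i : ℕ) : Bool := if h : i < n then y ⟨i, h⟩ else false

theorem pad_of_lt (y : Fin n → Bool) {i : ℕ} (h : i < n) : pad y i = y ⟨i, h⟩ := dif_pos h

@[simp]
theorem pad_coe (y : Fin n → Bool) (i : Fin n) : pad y i = y i := pad_of_lt y i.2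

theorem label_pad (l : Fin m ⊕ Fin n → Bool) :
    label (pad fun i => l (Sum.inl i)) (pad fun j => l (Sum.inr j)) = l := by
  funext p
  rcases p with i | j <;> simp [label]

theorem weight_congr {m' n' : ℕ} {w : BasisWeb m n} {v : BasisWeb m' n'} {x x' y y' : ℕ → Bool}
    (h : IsLabeling w x y ↔ IsLabeling v x' y') : weight w x y = weight v x' y' := by
  classical exact if_congr h rfl rfl

theorem isLabeling_congr (w : BasisWeb m n) {x x' y y' : ℕ → Bool}
    (hx : ∀ i < m, x i = x' i) (hy : ∀ i < n, y i = y' i) :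
    IsLabeling w x y ↔ IsLabeling w x' y' := by
  have h : (label x y : Fin m ⊕ Fin n → Bool) = label x' y' := by
    funext p
    rcases p with i | j
    · exact hx i i.2
    · exact hy j j.2
  simp only [IsLabeling, h]

theorem isLabeling_const (w : BasisWeb m n) (b : Bool) :
    IsLabeling w (fun _ => b) (fun _ => b) := by
  have h (p : Fin m ⊕ Fin n) : label (fun _ => b) (fun _ => b) p = b := by cases p <;> rfl
  exact fun p => (h _).trans (h p).symm

theorem BasisWeb.eq_of_isLabeling_imp {u v : BasisWeb m n}
    (h : ∀ x y, IsLabeling u x y → IsLabeling v x y) : u = v := by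
  ext p : 2
  let arc (o : Fin m ⊕ Fin n) : Bool := decide (o = p ∨ o = u.partner p)
  have harc (o) : arc (u.partner o) = arc o := by
    have h₁ : u.partner o = u.partner p ↔ o = p := u.perm.injective.eq_iff
    have h₂ : u.partner o = p ↔ o = u.partner p := u.perm.eq_symm_apply.symm
    rw [decide_eq_decide, h₁, h₂, or_comm]
  have hv := h (pad fun i => arc (Sum.inl i)) (pad fun j => arc (Sum.inr j))
  simp only [IsLabeling, label_pad arc] at hv
  have hp := (hv harc p).symm
  simp only [arc, true_or, decide_true, eq_comm (a := true), decide_eq_true_iff,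
    v.partner_ne, false_or] at hp
  exact hp.symm

theorem BasisWeb.eq_of_isLabeling_iff {u v : BasisWeb m n}
    (h : ∀ x y, IsLabeling u x y ↔ IsLabeling v x y) : u = v :=
  eq_of_isLabeling_imp fun x y => (h x y).1

theorem eq_and_eq_of_two_pow_mul_weight_eq {u v : BasisWeb m n} {k l : ℕ}
    (h : ∀ x y, 2 ^ k * weight u x y = 2 ^ l * weight v x y) : k = l ∧ u = v := by
  obtain rfl : k = l := by
    have := h (fun _ => false) (fun _ => false)
    simp only [weight, isLabeling_const, if_true, mul_one] at this
    exact Nat.pow_right_injective le_rfl this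
  refine ⟨rfl, BasisWeb.eq_of_isLabeling_imp fun x y hu => ?_⟩
  have := h x y
  by_contra hv
  simp [weight, hu, hv] at this

end Labelings

section Gluing

variable {a b c : ℕ}

/-- Counting labelings, the picture of `w` to the left of `v` looks like the web `u` together
with `k` closed loops. -/
def Glues (w : BasisWeb a b) (v : BasisWeb b c) (k : ℕ) (u : BasisWeb a c) : Prop :=
  ∀ x z, ∑ y : Fin b → Bool, weight w x (pad y) * weight v (pad y) z = 2 ^ k * weight u x z

theorem card_comp_eq_of_factorsThrough {ι C β : Type*} [Finite C] [Nonempty β] {f : ι → C}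
    {l : ι → β} (h : l.FactorsThrough f) :
    Nat.card {g : C → β // g ∘ f = l} = Nat.card β ^ Nat.card {c // ∀ i, f i ≠ c} := by
  classical
  obtain ⟨g₀, rfl⟩ := (Function.factorsThrough_iff l).1 h
  have hg (g : C → β) : g ∘ f = g₀ ∘ f ↔
      g ∘ ((↑) : {c // ∃ i, f i = c} → C) = g₀ ∘ (↑) := by
    simp only [funext_iff, Function.comp_apply, Subtype.forall, forall_exists_index,
      forall_apply_eq_imp_iff]
  rw [Nat.card_congr ((Equiv.subtypeEquivRight hg).trans (Equiv.subtypePreimage _ _)),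
    Nat.card_fun]
  simp only [not_exists, ne_eq]

variable (w : BasisWeb a b) (v : BasisWeb b c) (x z : ℕ → Bool)

/-- The labels of all points of a glued picture, `y` being the labels of the common side. -/
def gluedLabel (y : ℕ → Bool) : Fin a ⊕ Fin b ⊕ Fin c → Bool :=
  Sum.elim (fun i => x i) (label y z)

theorem gluedLabel_comp_outer (y : ℕ → Bool) :
    (gluedLabel x z y : Fin a ⊕ Fin b ⊕ Fin c → Bool) ∘ outer = label x z := by
  funext o
  cases o <;> rfl

theorem isLabeling_and_isLabeling_iff (y : ℕ → Bool) :
    IsLabeling w x y ∧ IsLabeling v y z ↔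
      ∀ p q, curveSetoid w v p q → gluedLabel x z y p = gluedLabel x z y q := by
  have hleft (p : Fin a ⊕ Fin b) :
      gluedLabel (c := c) x z y (Sum.map id Sum.inl p) = label x y p := by
    cases p <;> rfl
  constructor
  · rintro ⟨hw, hv⟩
    refine Setoid.eqvGen_le (s := Setoid.ker (gluedLabel x z y)) ?_
    rintro _ _ (p | p)
    · exact (hleft _).trans ((hw p).symm.trans (hleft _).symm)
    · exact (hv p).symm
  · intro h
    refine ⟨fun p => ?_, fun p => (h _ _ (.rel _ _ (.right p))).symm⟩
    rw [← hleft, ← hleft]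
    exact (h _ _ (.rel _ _ (.left p))).symm

/-- Labelings of a glued picture are functions on the set of its curves. -/
def labelingsEquiv :
    {y : Fin b → Bool // IsLabeling w x (pad y) ∧ IsLabeling v (pad y) z} ≃
      {g : Quotient (curveSetoid w v) → Bool // g ∘ Quotient.mk _ ∘ outer = label x z} where
  toFun y := ⟨Quotient.lift (gluedLabel x z (pad y.1)) ((isLabeling_and_isLabeling_iff ..).1 y.2),
    gluedLabel_comp_outer x z (pad y.1)⟩
  invFun g := by
    refine ⟨fun j => g.1 ⟦Sum.inr (Sum.inl j)⟧, (isLabeling_and_isLabeling_iff ..).2 ?_⟩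
    have h : gluedLabel x z (pad fun j => g.1 ⟦Sum.inr (Sum.inl j)⟧) = g.1 ∘ Quotient.mk _ := by
      funext p
      rcases p with i | j | k
      · exact (congrFun g.2 (Sum.inl i)).symm
      · exact pad_coe (fun j => g.1 ⟦Sum.inr (Sum.inl j)⟧) j
      · exact (congrFun g.2 (Sum.inr k)).symm
    intro p q hpq
    rw [h, Function.comp_apply, Function.comp_apply, Quotient.sound hpq]
  left_inv y := Subtype.ext (funext fun j => pad_coe y.1 j)
  right_inv g := by
    refine Subtype.ext (funext fun C => ?_)
    induction C using Quotient.inductionOn with | h p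
    rcases p with i | j | k
    · exact (congrFun g.2 (Sum.inl i)).symm
    · exact pad_coe (fun j => g.1 ⟦Sum.inr (Sum.inl j)⟧) j
    · exact (congrFun g.2 (Sum.inr k)).symm

theorem sum_weight_mul_weight :
    ∑ y : Fin b → Bool, weight w x (pad y) * weight v (pad y) z =
      Nat.card {y : Fin b → Bool // IsLabeling w x (pad y) ∧ IsLabeling v (pad y) z} := by
  classical
  rw [Nat.card_eq_fintype_card, Fintype.card_subtype, Finset.card_filter]
  simp only [weight, ite_and, mul_ite, mul_one, mul_zero]
  refine Finset.sum_congr rfl fun y _ => ?_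
  split_ifs <;> rfl

theorem isLabeling_gluedWeb_iff :
    IsLabeling (gluedWeb w v) x z ↔
      (label x z).FactorsThrough (Quotient.mk (curveSetoid w v) ∘ outer) := by
  constructor
  · intro h o o' ho
    rcases (curveSetoid_outer_iff w v).1 (Quotient.exact ho) with rfl | rfl
    · rfl
    · exact (h o).symm
  · exact fun h o => h (Quotient.sound ((curveSetoid_outer_iff w v).2 (.inr rfl)).symm)

theorem glues_gluedWeb : Glues w v (loopCount w v) (gluedWeb w v) := by
  intro x z
  rw [sum_weight_mul_weight, Nat.card_congr (labelingsEquiv w v x z), weight,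
    isLabeling_gluedWeb_iff]
  split_ifs with h
  · rw [card_comp_eq_of_factorsThrough h, Nat.card_eq_fintype_card (α := Bool), Fintype.card_bool,
      mul_one]
    rfl
  · rw [mul_zero, Nat.card_eq_zero]
    refine .inl ⟨fun ⟨g, hg⟩ => h fun o o' ho => ?_⟩
    rw [← hg]
    exact congrArg g ho

variable {w v}

theorem glueWeb_eq_of_glues {k : ℕ} {u : BasisWeb a c} (h : Glues w v k u) :
    glueWeb w v = (-qInt 2) ^ k • Finsupp.single u 1 := by
  obtain ⟨rfl, rfl⟩ := eq_and_eq_of_two_pow_mul_weight_eq fun x z =>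
    (h x z).symm.trans (glues_gluedWeb w v x z)
  rw [glueWeb_eq_single, Finsupp.smul_single, smul_eq_mul, mul_one]

end Gluing

theorem isLabeling_strandsWeb {m n : ℕ} (h : m = n) (x y : ℕ → Bool) :
    IsLabeling (strandsWeb h) x y ↔ ∀ i < m, x i = y i := by
  subst h
  constructor
  · exact fun h i hi => (h (Sum.inl ⟨i, hi⟩)).symm
  · rintro h (i | j)
    · exact (h i i.2).symm
    · exact h j j.2

theorem isLabeling_cupWeb (x y : ℕ → Bool) : IsLabeling cupWeb x y ↔ y 0 = y 1 := by
  refine ⟨fun h => h (Sum.inr 1), ?_⟩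
  rintro h (i | j)
  · exact i.elim0
  · fin_cases j
    · exact h.symm
    · exact h

theorem isLabeling_capWeb (x y : ℕ → Bool) : IsLabeling capWeb x y ↔ x 0 = x 1 := by
  refine ⟨fun h => h (Sum.inl 1), ?_⟩
  rintro h (i | j)
  · fin_cases i
    · exact h.symm
    · exact h
  · exact j.elim0

section Stack

variable {m n m' n' : ℕ}

theorem isLabeling_stackWeb (w : BasisWeb m n) (v : BasisWeb m' n') (x y : ℕ → Bool) :
    IsLabeling (stackWeb w v) x y ↔
      IsLabeling w x y ∧ IsLabeling v (fun i => x (m + i)) (fun i => y (n + i)) := by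
  have upper (p) : label x y (stackEquiv m n m' n' (Sum.inl p)) = label x y p := by
    cases p <;> simp [label, stackEquiv]
  have lower (p) : label x y (stackEquiv m n m' n' (Sum.inr p)) =
      label (fun i => x (m + i)) (fun i => y (n + i)) p := by
    cases p <;> simp [label, stackEquiv]
  simp only [IsLabeling, stackWeb, ← (stackEquiv m n m' n').forall_congr_right, Sum.forall,
    Equiv.symm_apply_apply, Sum.map_inl, Sum.map_inr, upper, lower]

theorem weight_stackWeb (w : BasisWeb m n) (v : BasisWeb m' n') (x y : ℕ → Bool) :
    weight (stackWeb w v) x y =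
      weight w x y * weight v (fun i => x (m + i)) (fun i => y (n + i)) := by
  have h := isLabeling_stackWeb w v x y
  unfold weight
  split_ifs <;> grind

theorem pad_append_of_lt (y : Fin m → Bool) (y' : Fin n → Bool) {i : ℕ} (hi : i < m) :
    pad (Fin.append y y') i = pad y i := by
  rw [pad_of_lt _ (Nat.lt_add_right n hi), pad_of_lt _ hi]
  exact Fin.append_left y y' ⟨i, hi⟩

theorem pad_append_add (y : Fin m → Bool) (y' : Fin n → Bool) {i : ℕ} (hi : i < n) :
    pad (Fin.append y y') (m + i) = pad y' i := by
  rw [pad_of_lt _ (Nat.add_lt_add_left hi m), pad_of_lt _ hi]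
  exact Fin.append_right y y' ⟨i, hi⟩

end Stack

theorem glues_stackWeb {a b c a' b' c' : ℕ} {w : BasisWeb a b} {v : BasisWeb b c} {u : BasisWeb a c}
    {w' : BasisWeb a' b'} {v' : BasisWeb b' c'} {u' : BasisWeb a' c'} {k k' : ℕ}
    (h : Glues w v k u) (h' : Glues w' v' k' u') :
    Glues (stackWeb w w') (stackWeb v v') (k + k') (stackWeb u u') := by
  intro x z
  have hsummand (y : Fin b → Bool) (y' : Fin b' → Bool) :
      weight (stackWeb w w') x (pad (Fin.append y y')) *
        weight (stackWeb v v') (pad (Fin.append y y')) z =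
      (weight w x (pad y) * weight v (pad y) z) * (weight w' (fun i => x (a + i)) (pad y') *
        weight v' (pad y') (fun i => z (c + i))) := by
    have hy (i : ℕ) (hi : i < b) := pad_append_of_lt y y' hi
    have hy' (i : ℕ) (hi : i < b') := pad_append_add y y' hi
    rw [weight_stackWeb, weight_stackWeb,
      weight_congr (isLabeling_congr w (fun _ _ => rfl) hy),
      weight_congr (isLabeling_congr v hy (fun _ _ => rfl)),
      weight_congr (isLabeling_congr w' (fun _ _ => rfl) hy'),
      weight_congr (isLabeling_congr v' hy' (fun _ _ => rfl)), mul_mul_mul_comm]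
  rw [← (Fin.appendEquiv b b').sum_comp, Fintype.sum_prod_type, weight_stackWeb u u', pow_add,
    mul_mul_mul_comm, ← h, ← h', Finset.sum_mul_sum]
  exact Finset.sum_congr rfl fun y _ => Finset.sum_congr rfl fun y' _ => hsummand y y'

theorem glues_strandsWeb_left {b c : ℕ} (v : BasisWeb b c) : Glues (strandsWeb rfl) v 0 v := by
  intro x z
  rw [Fintype.sum_eq_single (fun i : Fin b => x i)]
  · have h (i : ℕ) (hi : i < b) : pad (fun i : Fin b => x i) i = x i := pad_of_lt _ hi
    rw [weight, if_pos ((isLabeling_strandsWeb rfl _ _).2 fun i hi => (h i hi).symm),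
      weight_congr (isLabeling_congr v h fun _ _ => rfl), pow_zero]
  · intro y hy
    rw [weight, if_neg, zero_mul]
    rw [isLabeling_strandsWeb]
    exact fun h => hy (funext fun i => ((h i i.2).trans (pad_coe y i)).symm)

theorem glues_strandsWeb_right {a b : ℕ} (w : BasisWeb a b) : Glues w (strandsWeb rfl) 0 w := by
  intro x z
  rw [Fintype.sum_eq_single (fun i : Fin b => z i)]
  · have h (i : ℕ) (hi : i < b) : pad (fun i : Fin b => z i) i = z i := pad_of_lt _ hi
    rw [mul_comm, weight, if_pos ((isLabeling_strandsWeb rfl _ _).2 h),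
      weight_congr (isLabeling_congr w (fun _ _ => rfl) h), pow_zero]
  · intro y hy
    rw [mul_comm, weight, if_neg, zero_mul]
    rw [isLabeling_strandsWeb]
    exact fun h => hy (funext fun i => (pad_coe y i).symm.trans (h i i.2))

/-! ### Gluing and placing elements of web spaces -/

theorem glue_single {a b c : ℕ} (w : BasisWeb a b) (v : BasisWeb b c) (r s : K) :
    glue (Finsupp.single w r) (Finsupp.single v s) = (r * s) • glueWeb w v := by
  simp [glue, smul_smul]

theorem glue_single_of_glues {a b c : ℕ} {w : BasisWeb a b} {v : BasisWeb b c} {k : ℕ}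
    {u : BasisWeb a c} (h : Glues w v k u) (r s : K) :
    glue (Finsupp.single w r) (Finsupp.single v s) =
      Finsupp.single u (r * s * (-qInt 2) ^ k) := by
  rw [glue_single, glueWeb_eq_of_glues h, smul_smul, Finsupp.smul_single, smul_eq_mul, mul_one]

theorem stack_single {m n m' n' : ℕ} (w : BasisWeb m n) (v : BasisWeb m' n') (r s : K) :
    stack (Finsupp.single w r) (Finsupp.single v s) = Finsupp.single (stackWeb w v) (r * s) := by
  simp [stack]

theorem glue_assoc {a b c d : ℕ} (x : W a b) (y : W b c) (z : W c d) :
    glue (glue x y) z = glue x (glue y z) := by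
  induction x using Finsupp.induction_linear with
  | zero => simp
  | add x x' hx hx' => simp [hx, hx']
  | single w r =>
  induction y using Finsupp.induction_linear with
  | zero => simp
  | add y y' hy hy' => simp [hy, hy']
  | single v s =>
  induction z using Finsupp.induction_linear with
  | zero => simp
  | add z z' hz hz' => simp [hz, hz']
  | single u p =>
  have hwv := glues_gluedWeb w v
  have hwv_u := glues_gluedWeb (gluedWeb w v) u
  have hvu := glues_gluedWeb v u
  have hw_vu := glues_gluedWeb w (gluedWeb v u)
  obtain ⟨hloops, hweb⟩ : loopCount w v + loopCount (gluedWeb w v) u =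
        loopCount v u + loopCount w (gluedWeb v u) ∧
      gluedWeb (gluedWeb w v) u = gluedWeb w (gluedWeb v u) := by
    refine eq_and_eq_of_two_pow_mul_weight_eq fun x z => ?_
    simp only [Glues] at hwv hwv_u hvu hw_vu
    rw [pow_add, pow_add, mul_assoc, mul_assoc, ← hwv_u, ← hw_vu]
    simp only [Finset.mul_sum, ← mul_assoc, ← hwv]
    simp only [mul_comm (2 ^ _) (weight w x _), mul_assoc, ← hvu]
    simp only [Finset.sum_mul, Finset.mul_sum]
    rw [Finset.sum_comm]
    simp only [mul_assoc]
  rw [glue_single_of_glues hwv, glue_single_of_glues hwv_u, glue_single_of_glues hvu,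
    glue_single_of_glues hw_vu, hweb, mul_right_comm _ _ p, mul_assoc _ (_ ^ _), ← pow_add, hloops,
    pow_add]
  congr 1
  ring

theorem glue_stack_stack {a b c a' b' c' : ℕ} (x : W a b) (x' : W a' b') (y : W b c)
    (y' : W b' c') : glue (stack x x') (stack y y') = stack (glue x y) (glue x' y') := by
  induction x using Finsupp.induction_linear with
  | zero => simp
  | add x₁ x₂ h₁ h₂ => simp [h₁, h₂]
  | single w r =>
  induction x' using Finsupp.induction_linear with
  | zero => simp
  | add x₁ x₂ h₁ h₂ => simp [h₁, h₂]
  | single w' r' =>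
  induction y using Finsupp.induction_linear with
  | zero => simp
  | add y₁ y₂ h₁ h₂ => simp [h₁, h₂]
  | single v s =>
  induction y' using Finsupp.induction_linear with
  | zero => simp
  | add y₁ y₂ h₁ h₂ => simp [h₁, h₂]
  | single v' s' =>
  have h := glues_gluedWeb w v
  have h' := glues_gluedWeb w' v'
  rw [stack_single, stack_single, glue_single_of_glues h, glue_single_of_glues h', stack_single,
    glue_single_of_glues (glues_stackWeb h h'), pow_add]
  congr 1
  ring

theorem glue_bracket_strands_left {b c : ℕ} (x : W b c) : glue (bracket (strands b)) x = x := by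
  induction x using Finsupp.induction_linear with
  | zero => simp
  | add x x' hx hx' => rw [map_add, hx, hx']
  | single w r => simp [strands, bracket, glue_single_of_glues (glues_strandsWeb_left w)]

theorem glue_bracket_strands_right {a b : ℕ} (x : W a b) : glue x (bracket (strands b)) = x := by
  induction x using Finsupp.induction_linear with
  | zero => simp
  | add x x' hx hx' => rw [map_add, LinearMap.add_apply, hx, hx']
  | single w r => simp [strands, bracket, glue_single_of_glues (glues_strandsWeb_right w)]

section Place

variable {m n l N N' N'' : ℕ}

/-- `w` with `a` horizontal strands above and `b` horizontal strands below. The numbers of marked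
points may be given by arbitrary expressions `N` and `N'`. -/
def placeWeb (a b : ℕ) (hm : a + m + b = N) (hn : a + n + b = N') (w : BasisWeb m n) :
    BasisWeb N N' :=
  hm ▸ hn ▸ stackWeb (stackWeb (strandsWeb (rfl : a = a)) w) (strandsWeb (rfl : b = b))

theorem isLabeling_placeWeb (a b : ℕ) (hm : a + m + b = N) (hn : a + n + b = N')
    (w : BasisWeb m n) (x y : ℕ → Bool) :
    IsLabeling (placeWeb a b hm hn w) x y ↔ (∀ i < a, x i = y i) ∧
      IsLabeling w (fun i => x (a + i)) (fun i => y (a + i)) ∧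
      ∀ i < b, x (a + m + i) = y (a + n + i) := by
  subst hm hn
  simp only [placeWeb, isLabeling_stackWeb, isLabeling_strandsWeb, and_assoc]

/-- Linear extension of `placeWeb` to web spaces. -/
def place (a b : ℕ) (hm : a + m + b = N) (hn : a + n + b = N') : W m n →ₗ[K] W N N' :=
  Finsupp.lmapDomain K K (placeWeb a b hm hn)

theorem place_single (a b : ℕ) (hm : a + m + b = N) (hn : a + n + b = N') (w : BasisWeb m n)
    (r : K) : place a b hm hn (Finsupp.single w r) = Finsupp.single (placeWeb a b hm hn w) r := by
  simp [place]

theorem place_eq_stack (a b : ℕ) (x : W m n) :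
    place a b rfl rfl x = stack (stack (bracket (strands a)) x) (bracket (strands b)) := by
  induction x using Finsupp.induction_linear with
  | zero => simp
  | add x x' hx hx' => simp [hx, hx']
  | single w r => simp [place_single, strands, bracket, stack_single, placeWeb]

theorem place_glue (a b : ℕ) (hm : a + m + b = N) (hn : a + n + b = N') (hl : a + l + b = N'')
    (x : W m n) (y : W n l) :
    place a b hm hl (glue x y) = glue (place a b hm hn x) (place a b hn hl y) := by
  subst hm hn hl
  simp only [place_eq_stack, glue_stack_stack, glue_bracket_strands_left]

theorem forall_lt_add_iff {a b : ℕ} {p : ℕ → Prop} :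
    (∀ i < a + b, p i) ↔ (∀ i < a, p i) ∧ ∀ i < b, p (a + i) := by
  refine ⟨fun h => ⟨fun i hi => h i (by omega), fun i hi => h _ (by omega)⟩, fun h i hi => ?_⟩
  obtain hi | ⟨j, rfl⟩ := (lt_or_ge i a).imp_right Nat.exists_eq_add_of_le
  · exact h.1 i hi
  · exact h.2 j (by omega)

theorem place_place (a b a' b' : ℕ) {M M' : ℕ} (hm : a + m + b = N) (hn : a + n + b = N')
    (hM : a' + N + b' = M) (hM' : a' + N' + b' = M') (x : W m n) :
    place a' b' hM hM' (place a b hm hn x) =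
      place (a' + a) (b + b') (by omega) (by omega) x := by
  induction x using Finsupp.induction_linear with
  | zero => simp
  | add x x' hx hx' => simp [hx, hx']
  | single w r =>
  subst hm hn
  simp only [place_single]
  congr 1
  refine BasisWeb.eq_of_isLabeling_iff fun x y => ?_
  simp only [isLabeling_placeWeb, forall_lt_add_iff, add_assoc, and_assoc]

theorem place_bracket_strands (a b : ℕ) (hm : a + m + b = N) (hn : a + n + b = N') (h : m = n) :
    place a b hm hn (bracket (.strands h)) = bracket (.strands (by omega)) := by
  subst h hm hn
  simp only [bracket, place_single]
  congr 1
  refine BasisWeb.eq_of_isLabeling_iff fun x y => ?_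
  simp only [isLabeling_placeWeb, isLabeling_strandsWeb, forall_lt_add_iff, add_assoc]

theorem place_zero_zero (hm : 0 + m + 0 = m) (hn : 0 + n + 0 = n) (x : W m n) :
    place 0 0 hm hn x = x := by
  induction x using Finsupp.induction_linear with
  | zero => simp
  | add x x' hx hx' => simp [hx, hx']
  | single w r =>
  rw [place_single]
  congr 1
  exact BasisWeb.eq_of_isLabeling_iff fun x y => by simp [isLabeling_placeWeb]

theorem glue_bracket_strands_eq_place {a b c : ℕ} (h : a = b) (x : W b c) :
    glue (bracket (.strands h)) x = place 0 0 (by omega) (by omega) x := by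
  subst h
  rw [place_zero_zero, ← strands, glue_bracket_strands_left]

theorem glue_eq_place_of_bracket_strands {a b c : ℕ} (h : b = c) (x : W a b) :
    glue x (bracket (.strands h)) = place 0 0 (by omega) (by omega) x := by
  subst h
  rw [place_zero_zero, ← strands, glue_bracket_strands_right]

theorem stack_bracket_strands_right (k : ℕ) (x : W m n) :
    stack x (bracket (strands k)) = place 0 k (by omega) (by omega) x := by
  induction x using Finsupp.induction_linear with
  | zero => simp
  | add x x' hx hx' => simp [hx, hx']
  | single w r =>
  simp only [strands, bracket, stack_single, place_single, mul_one]
  congr 1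
  refine BasisWeb.eq_of_isLabeling_iff fun x y => ?_
  simp [isLabeling_stackWeb, isLabeling_strandsWeb, isLabeling_placeWeb]

theorem stack_bracket_strands_left (k : ℕ) (x : W m n) :
    stack (bracket (strands k)) x = place k 0 (by omega) (by omega) x := by
  induction x using Finsupp.induction_linear with
  | zero => simp
  | add x x' hx hx' => simp [hx, hx']
  | single w r =>
  simp only [strands, bracket, stack_single, place_single, one_mul]
  congr 1
  refine BasisWeb.eq_of_isLabeling_iff fun x y => ?_
  simp [isLabeling_stackWeb, isLabeling_strandsWeb, isLabeling_placeWeb]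

theorem stack_eq_glue {m' n' : ℕ} (x : W m n) (y : W m' n') :
    stack x y = glue (place 0 m' (by omega) (by omega) x : W (m + m') (n + m'))
      (place n 0 (by omega) (by omega) y) := by
  rw [← stack_bracket_strands_right, ← stack_bracket_strands_left, glue_stack_stack,
    glue_bracket_strands_left, glue_bracket_strands_right]

theorem stack_eq_glue' {m' n' : ℕ} (x : W m n) (y : W m' n') :
    stack x y = glue (place m 0 (by omega) (by omega) y : W (m + m') (m + n'))
      (place 0 n' (by omega) (by omega) x) := by
  rw [← stack_bracket_strands_right, ← stack_bracket_strands_left, glue_stack_stack,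
    glue_bracket_strands_left, glue_bracket_strands_right]

end Place

theorem glue_cup_cap : glue (bracket .cup) (bracket .cap) = (-qInt 2) • emptyDisk := by
  have h : Glues cupWeb capWeb 1 (strandsWeb (rfl : 0 = 0)) := by
    intro x z
    have h : ∑ y : Fin 2 → Bool, (if y 0 = y 1 then if y 0 = y 1 then 1 else 0 else 0) = 2 := by
      decide
    simpa [-Finset.sum_boole, weight, isLabeling_cupWeb, isLabeling_capWeb,
      isLabeling_strandsWeb, pad] using h
  rw [bracket, bracket, glue_single_of_glues h, emptyDisk, Finsupp.smul_single]
  simp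

theorem glue_place_cup_place_cap :
    glue (place 0 1 (by omega) (by omega) (bracket .cup) : W 1 3)
      (place 1 0 (by omega) (by omega) (bracket .cap) : W 3 1) = bracket (strands 1) := by
  have h : Glues (placeWeb 0 1 (by omega) (by omega) cupWeb : BasisWeb 1 3)
      (placeWeb 1 0 (by omega) (by omega) capWeb : BasisWeb 3 1) 0 (strandsWeb rfl) := by
    intro x z
    have h (p r : Bool) : ∑ y : Fin 3 → Bool, (if y 0 = y 1 ∧ p = y 2 then 1 else 0) *
        (if y 0 = r ∧ y 1 = y 2 then 1 else 0) = if p = r then 1 else 0 := by decide +revert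
    simpa [weight, isLabeling_cupWeb, isLabeling_capWeb, isLabeling_strandsWeb,
      isLabeling_placeWeb, pad] using h (x 0) (z 0)
  simp only [bracket, strands, place_single, glue_single_of_glues h, mul_one, pow_zero]

theorem glue_place_cup_place_cap' :
    glue (place 1 0 (by omega) (by omega) (bracket .cup) : W 1 3)
      (place 0 1 (by omega) (by omega) (bracket .cap) : W 3 1) = bracket (strands 1) := by
  have h : Glues (placeWeb 1 0 (by omega) (by omega) cupWeb : BasisWeb 1 3)
      (placeWeb 0 1 (by omega) (by omega) capWeb : BasisWeb 3 1) 0 (strandsWeb rfl) := by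
    intro x z
    have h (p r : Bool) : ∑ y : Fin 3 → Bool, (if p = y 0 ∧ y 1 = y 2 then 1 else 0) *
        (if y 0 = y 1 ∧ y 2 = r then 1 else 0) = if p = r then 1 else 0 := by decide +revert
    simpa [weight, isLabeling_cupWeb, isLabeling_capWeb, isLabeling_strandsWeb,
      isLabeling_placeWeb, pad] using h (x 0) (z 0)
  simp only [bracket, strands, place_single, glue_single_of_glues h, mul_one, pow_zero]

/-! ### Quantum integers -/

theorem t_ne_zero : t ≠ 0 := RatFunc.X_ne_zero

theorem t_pow_ne_one {n : ℕ} (hn : n ≠ 0) : t ^ n ≠ 1 := by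
  intro h
  rw [t, ← RatFunc.algebraMap_X, ← map_pow, ← map_one (algebraMap (Polynomial ℚ) (RatFunc ℚ))] at h
  have hdeg := congrArg Polynomial.natDegree (RatFunc.algebraMap_injective ℚ h)
  rw [Polynomial.natDegree_X_pow, Polynomial.natDegree_one] at hdeg
  exact hn hdeg

theorem t_zpow_ne_one {k : ℤ} (hk : k ≠ 0) : t ^ k ≠ 1 := by
  obtain ⟨n, rfl | rfl⟩ := k.eq_nat_or_neg
  · exact_mod_cast t_pow_ne_one (by simpa using hk)
  · rw [zpow_neg, inv_ne_one]
    exact_mod_cast t_pow_ne_one (by simpa using hk)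

theorem qBrace_ne_zero {k : ℤ} (hk : k ≠ 0) : qBrace k ≠ 0 := by
  intro h
  refine t_zpow_ne_one (k := 2 * k + 2 * k) (by omega) ?_
  rw [zpow_add₀ t_ne_zero]
  nth_rewrite 1 [sub_eq_zero.1 h]
  rw [← zpow_add₀ t_ne_zero, neg_add_cancel, zpow_zero]

theorem qInt_ne_zero {k : ℤ} (hk : k ≠ 0) : qInt k ≠ 0 :=
  div_ne_zero (qBrace_ne_zero hk) (qBrace_ne_zero one_ne_zero)

theorem qInt_one : qInt 1 = 1 := div_self (qBrace_ne_zero one_ne_zero)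

theorem qInt_two : qInt 2 = t ^ 2 + t⁻¹ ^ 2 := by
  have ht := t_ne_zero
  rw [qInt, div_eq_iff (qBrace_ne_zero one_ne_zero)]
  simp only [qBrace, Int.reduceMul, zpow_neg]
  field_simp
  ring

theorem qInt_add_two (k : ℤ) : qInt (k + 2) = qInt 2 * qInt (k + 1) - qInt k := by
  have h₁ := qBrace_ne_zero one_ne_zero
  have h : qBrace (k + 2) * qBrace 1 = qBrace 2 * qBrace (k + 1) - qBrace k * qBrace 1 := by
    simp only [qBrace, mul_sub, sub_mul, ← zpow_add₀ t_ne_zero]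
    ring_nf
  simp only [qInt]
  field_simp
  linear_combination h

/-! ### Temperley--Lieb relations and Jones--Wenzl projectors -/

/-- The relations between the generators `e 0`, …, `e (N - 2)` of the Temperley--Lieb algebra on `N`
strands with loop value `δ`. The remaining elements of the sequence `e` are thought of as zero,
whence the bound on `i` in just one of the relations. -/
structure TLRel {R A : Type*} [CommRing R] [Ring A] [Algebra R A] (δ : R) (N : ℕ) (e : ℕ → A) :
    Prop where
  mul_self : ∀ i, e i * e i = δ • e i
  commute : ∀ i j, i + 2 ≤ j → Commute (e i) (e j)
  succ_mul_mul_succ : ∀ i, e (i + 1) * e i * e (i + 1) = e (i + 1)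
  mul_succ_mul : ∀ i, i + 2 < N → e i * e (i + 1) * e i = e i

namespace TLRel

variable {R A : Type*} [CommRing R] [Ring A] [Algebra R A] {δ : R} {N : ℕ} {e : ℕ → A}

theorem shift (h : TLRel δ N e) (s : ℕ) : TLRel δ (N - s) fun i => e (s + i) where
  mul_self _ := h.mul_self _
  commute _ _ hij := h.commute _ _ (by omega)
  succ_mul_mul_succ _ := h.succ_mul_mul_succ _
  mul_succ_mul _ hi := h.mul_succ_mul _ (by omega)

theorem op (h : TLRel δ N e) : TLRel δ N fun i => MulOpposite.op (e i) where
  mul_self i := by rw [← MulOpposite.op_mul, h.mul_self, MulOpposite.op_smul]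
  commute i j hij := (h.commute i j hij).op
  succ_mul_mul_succ i := by
    rw [mul_assoc, ← MulOpposite.op_mul, ← MulOpposite.op_mul, h.succ_mul_mul_succ]
  mul_succ_mul i hi := by
    rw [mul_assoc, ← MulOpposite.op_mul, ← MulOpposite.op_mul, h.mul_succ_mul i hi]

end TLRel

section JonesWenzl

variable {A : Type*} [Ring A] [Algebra K A] {N : ℕ} {e : ℕ → A}

/-- The Jones--Wenzl projector on `k` strands in terms of generators `e 0`, …, `e (k - 2)` of a
Temperley--Lieb algebra. -/
def jw (e : ℕ → A) : ℕ → A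
  | 0 => 1
  | 1 => 1
  | k + 2 => jw e (k + 1) + (qInt (k + 1) / qInt (k + 2)) • (jw e (k + 1) * e k * jw e (k + 1))

theorem jw_add_two (e : ℕ → A) (k : ℕ) :
    jw e (k + 2) =
      jw e (k + 1) + (qInt (k + 1) / qInt (k + 2)) • (jw e (k + 1) * e k * jw e (k + 1)) :=
  rfl

theorem op_jw (e : ℕ → A) : ∀ k, MulOpposite.op (jw e k) = jw (fun i => MulOpposite.op (e i)) k
  | 0 | 1 => rfl
  | k + 2 => by
    rw [jw_add_two, jw_add_two, ← op_jw e (k + 1), MulOpposite.op_add, MulOpposite.op_smul,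
      MulOpposite.op_mul, MulOpposite.op_mul, mul_assoc]

theorem commute_jw {x : A} : ∀ {k : ℕ}, (∀ i, i + 2 ≤ k → Commute x (e i)) → Commute x (jw e k)
  | 0, _ | 1, _ => Commute.one_right x
  | k + 2, hx => by
    have hk : Commute x (jw e (k + 1)) := commute_jw fun i hi => hx i (by omega)
    exact hk.add_right (((hk.mul_right (hx k le_rfl)).mul_right hk).smul_right _)

theorem jw_mul_jw_succ_of_isIdempotentElem :
    ∀ {k : ℕ}, IsIdempotentElem (jw e k) → jw e k * jw e (k + 1) = jw e (k + 1)
  | 0, _ => one_mul _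
  | k + 1, hk => by
    rw [jw_add_two, mul_add, mul_smul_comm, ← mul_assoc, ← mul_assoc, hk.eq]

namespace TLRel

variable (h : TLRel (-qInt 2) N e)

include h

theorem commute_gen_jw {k m : ℕ} (hm : k ≤ m) : Commute (e m) (jw e k) :=
  commute_jw fun i hi => (h.commute i m (by omega)).symm

/-- Algebraically, this computes the closure of the last strand of a Jones--Wenzl projector. -/
theorem gen_mul_jw_mul_gen_of_isIdempotentElem {k : ℕ} (hk : IsIdempotentElem (jw e k)) :
    e k * jw e (k + 1) * e k = (-(qInt (k + 2) / qInt (k + 1))) • (jw e k * e k) := by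
  obtain - | k := k
  · simp [jw, h.mul_self, qInt_one]
  have hcomm : e (k + 1) * jw e (k + 1) = jw e (k + 1) * e (k + 1) := h.commute_gen_jw le_rfl
  have hsq : e (k + 1) * jw e (k + 1) * e (k + 1) = (-qInt 2) • (jw e (k + 1) * e (k + 1)) := by
    rw [hcomm, mul_assoc, h.mul_self, mul_smul_comm]
  have hcubic : e (k + 1) * (jw e (k + 1) * e k * jw e (k + 1)) * e (k + 1) =
      jw e (k + 1) * e (k + 1) := by
    calc _ = e (k + 1) * jw e (k + 1) * e k * (jw e (k + 1) * e (k + 1)) := by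
          simp only [mul_assoc]
      _ = jw e (k + 1) * e (k + 1) * e k * (e (k + 1) * jw e (k + 1)) := by rw [hcomm]
      _ = jw e (k + 1) * (e (k + 1) * e k * e (k + 1)) * jw e (k + 1) := by simp only [mul_assoc]
      _ = jw e (k + 1) * e (k + 1) := by
          rw [h.succ_mul_mul_succ, mul_assoc, hcomm, ← mul_assoc, hk.eq]
  have hcoeff : -qInt 2 + qInt ((k : ℤ) + 1) / qInt ((k : ℤ) + 2) =
      -(qInt (((k + 1 : ℕ) : ℤ) + 2) / qInt (((k + 1 : ℕ) : ℤ) + 1)) := by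
    have hk₂ : qInt ((k : ℤ) + 2) ≠ 0 := qInt_ne_zero (by omega)
    have hrec := qInt_add_two ((k : ℤ) + 1)
    rw [add_assoc (k : ℤ) 1 1, one_add_one_eq_two] at hrec
    rw [Nat.cast_succ, hrec, add_assoc (k : ℤ) 1 1, one_add_one_eq_two]
    field_simp
    ring
  rw [jw_add_two, mul_add, add_mul, mul_smul_comm, smul_mul_assoc, hsq, hcubic, ← add_smul, hcoeff]

theorem gen_mul_jw_add_two_of_isIdempotentElem {k : ℕ} (hk : IsIdempotentElem (jw e k)) :
    e k * jw e (k + 2) = 0 := by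
  have hk₁ : qInt ((k : ℤ) + 1) ≠ 0 := qInt_ne_zero (by omega)
  have hk₂ : qInt ((k : ℤ) + 2) ≠ 0 := qInt_ne_zero (by omega)
  rw [jw_add_two, mul_add, mul_smul_comm, ← mul_assoc, ← mul_assoc,
    h.gen_mul_jw_mul_gen_of_isIdempotentElem hk, smul_mul_assoc, smul_smul,
    ← (h.commute_gen_jw le_rfl).eq, mul_assoc, jw_mul_jw_succ_of_isIdempotentElem hk, mul_neg,
    div_mul_div_cancel₀' hk₁, div_self hk₂, neg_one_smul, add_neg_cancel]

theorem isIdempotentElem_jw : ∀ k, IsIdempotentElem (jw e k)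
  | 0 | 1 => IsIdempotentElem.one
  | k + 2 => by
    have habsorb := jw_mul_jw_succ_of_isIdempotentElem (isIdempotentElem_jw (k + 1))
    have hkill := h.gen_mul_jw_add_two_of_isIdempotentElem (isIdempotentElem_jw k)
    rw [IsIdempotentElem]
    nth_rewrite 1 [jw_add_two]
    rw [add_mul, smul_mul_assoc, mul_assoc, habsorb, mul_assoc, hkill, mul_zero, smul_zero,
      add_zero]

theorem gen_mul_jw_mul_gen (k : ℕ) :
    e k * jw e (k + 1) * e k = (-(qInt (k + 2) / qInt (k + 1))) • (jw e k * e k) :=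
  h.gen_mul_jw_mul_gen_of_isIdempotentElem (h.isIdempotentElem_jw k)

theorem gen_mul_jw {k m : ℕ} (hm : m + 2 ≤ k) : e m * jw e k = 0 := by
  induction k, hm using Nat.le_induction with
  | base => exact h.gen_mul_jw_add_two_of_isIdempotentElem (h.isIdempotentElem_jw m)
  | succ k _ ih =>
    rw [← jw_mul_jw_succ_of_isIdempotentElem (h.isIdempotentElem_jw k), ← mul_assoc, ih, zero_mul]

theorem jw_mul_gen {k m : ℕ} (hm : m + 2 ≤ k) : jw e k * e m = 0 := by
  apply MulOpposite.op_injective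
  rw [MulOpposite.op_mul, op_jw, h.op.gen_mul_jw hm, MulOpposite.op_zero]

end TLRel

end JonesWenzl

/-! ### Words in the generators -/

section Words

variable {M : Type*} [Monoid M]

/-- The descending word `e (p + k - 1) * ⋯ * e (p + 1) * e p` of length `k`. -/
def desc (e : ℕ → M) (p : ℕ) : ℕ → M
  | 0 => 1
  | k + 1 => e (p + k) * desc e p k

/-- The product `desc e p a * desc e (p + 1) a * ⋯ * desc e (p + j - 1) a`. For Temperley--Lieb
generators and `a = j` it is the diagram with `p` through strands at the top followed by `j` nested
turnbacks on either side. -/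
def rows (e : ℕ → M) (p a : ℕ) : ℕ → M
  | 0 => 1
  | j + 1 => rows e p a j * desc e (p + j) a

variable (e : ℕ → M)

theorem desc_add (p k l : ℕ) : desc e p (k + l) = desc e (p + k) l * desc e p k := by
  induction l with
  | zero => rw [add_zero, desc, one_mul]
  | succ l ih => rw [← add_assoc, desc, ih, desc, mul_assoc, add_assoc]

theorem desc_one (p : ℕ) : desc e p 1 = e p := mul_one _

theorem desc_succ' (p k : ℕ) : desc e p (k + 1) = desc e (p + 1) k * e p := by
  rw [add_comm, desc_add, desc_one]

theorem rows_add (p a j k : ℕ) : rows e p a (j + k) = rows e p a j * rows e (p + j) a k := by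
  induction k with
  | zero => rw [add_zero, rows, mul_one]
  | succ k ih => rw [← add_assoc, rows, ih, rows, mul_assoc, add_assoc]

theorem rows_one (p a : ℕ) : rows e p a 1 = desc e p a := one_mul _

theorem rows_succ' (p a j : ℕ) : rows e p a (j + 1) = desc e p a * rows e (p + 1) a j := by
  rw [add_comm, rows_add, rows_one]

variable {e} {x : M} {p : ℕ}

theorem commute_desc {k : ℕ} (hx : ∀ i, p ≤ i → i < p + k → Commute x (e i)) :
    Commute x (desc e p k) := by
  induction k with
  | zero => exact Commute.one_right x
  | succ k ih =>
    exact (hx _ (by omega) (by omega)).mul_right (ih fun i hpi hi => hx i hpi (by omega))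

theorem commute_rows {a j : ℕ} (hx : ∀ i, p ≤ i → i + 1 < p + a + j → Commute x (e i)) :
    Commute x (rows e p a j) := by
  induction j with
  | zero => exact Commute.one_right x
  | succ j ih =>
    exact (ih fun i hpi hi => hx i hpi (by omega)).mul_right
      (commute_desc fun i hpi hi => hx i (by omega) (by omega))

end Words

namespace TLRel

variable {R A : Type*} [CommRing R] [Ring A] [Algebra R A] {δ : R} {N : ℕ} {e : ℕ → A}
  (h : TLRel δ N e)

include h

theorem desc_mul_desc (p r i : ℕ) (hN : p + r + i + 2 < N) :
    desc e (p + r) (i + 1) * desc e p (r + i + 2) =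
      desc e p (r + i + 1) * desc e (p + r + 2) i := by
  induction i with
  | zero =>
    simp only [desc, mul_one, add_zero]
    rw [← mul_assoc, ← mul_assoc, ← add_assoc p r 1, h.mul_succ_mul _ (by omega)]
  | succ i ih =>
    have hleft : Commute (e (p + r + i + 2)) (desc e (p + r) (i + 1)) :=
      commute_desc fun m _ hm => (h.commute _ _ (by omega)).symm
    have hright : Commute (e (p + r + i + 2)) (desc e p (r + i + 1)) :=
      commute_desc fun m _ hm => (h.commute _ _ (by omega)).symm
    have hlong : desc e p (r + (i + 1) + 2) = e (p + r + i + 2) * desc e p (r + i + 2) := by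
      rw [show r + (i + 1) + 2 = r + i + 2 + 1 by ring, desc, ← add_assoc, ← add_assoc]
    have hshort : desc e p (r + (i + 1) + 1) = e (p + r + i + 1) * desc e p (r + i + 1) := by
      rw [← add_assoc, desc, ← add_assoc, ← add_assoc]
    have hlast : desc e (p + r + 2) (i + 1) = e (p + r + i + 2) * desc e (p + r + 2) i := by
      rw [desc, add_right_comm]
    calc desc e (p + r) (i + 1 + 1) * desc e p (r + (i + 1) + 2)
      _ = e (p + r + i + 1) * (desc e (p + r) (i + 1) * e (p + r + i + 2)) *
          desc e p (r + i + 2) := by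
        rw [hlong, desc, ← add_assoc (p + r) i 1]; simp only [mul_assoc]
      _ = e (p + r + i + 1) * e (p + r + i + 2) *
          (desc e (p + r) (i + 1) * desc e p (r + i + 2)) := by
        rw [← hleft.eq]; simp only [mul_assoc]
      _ = e (p + r + i + 1) * (e (p + r + i + 2) * desc e p (r + i + 1)) *
          desc e (p + r + 2) i := by
        rw [ih (by omega)]; simp only [mul_assoc]
      _ = desc e p (r + (i + 1) + 1) * desc e (p + r + 2) (i + 1) := by
        rw [hright.eq, hshort, hlast]; simp only [mul_assoc]

theorem desc_mul_rows (p r s j : ℕ) (hN : p + r + 2 * j + s + 1 ≤ N) :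
    desc e (p + r) (j + s) * rows e p (r + j + s + 1) j =
      rows e p (r + j + s) j * desc e (p + r + 2 * j) s := by
  induction j generalizing s with
  | zero => simp only [rows, mul_one, one_mul, mul_zero, add_zero, zero_add]
  | succ j ih =>
    have hfirst := ih (s + 1) (by omega)
    have hlast := h.desc_mul_desc (p + j) (r + j) s (by omega)
    rw [show p + j + (r + j) = p + r + 2 * j by ring,
      show r + j + s + 2 = r + (j + 1) + s + 1 by ring,
      show r + j + s + 1 = r + (j + 1) + s by ring] at hlast
    rw [show j + (s + 1) = j + 1 + s by ring, show r + j + (s + 1) = r + (j + 1) + s by ring]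
      at hfirst
    rw [rows, ← mul_assoc, hfirst, mul_assoc, hlast, ← mul_assoc]
    rfl

theorem desc_mul_rows_self (p r j : ℕ) (hN : p + r + 2 * j + 1 ≤ N) :
    desc e (p + r) j * rows e p (r + j + 1) j = rows e p (r + j) j := by
  simpa only [desc, add_zero, mul_one] using h.desc_mul_rows p r 0 j hN

theorem desc_mul_rows_mul_eq_zero {p r s j : ℕ} {f : A} (hN : p + r + 2 * j + s + 2 ≤ N)
    (hf : e (p + r + 2 * j) * f = 0) :
    desc e (p + r) (j + (s + 1)) * rows e p (r + j + s + 2) j * f = 0 := by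
  have hslide := h.desc_mul_rows p r (s + 1) j (by omega)
  rw [← add_assoc (r + j) s 1] at hslide
  rw [hslide, desc_succ', mul_assoc, mul_assoc, hf, mul_zero, mul_zero]

theorem mul_desc_mul_rows_eq_zero {p r i k : ℕ} {v : A} (hN : p + r + 2 * i + 1 ≤ N)
    (hv : v * e (p + r + 2 * i) = 0) :
    v * (desc e (p + r) i * rows e p (r + i + 1) (i + (k + 1))) = 0 := by
  have hcomm : Commute (e (p + r + 2 * i)) (rows e p (r + i) i) :=
    commute_rows fun m _ hm => (h.commute m _ (by omega)).symm
  rw [rows_add, rows_succ', ← mul_assoc (desc e _ _), h.desc_mul_rows_self p r i hN, desc,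
    show p + i + (r + i) = p + r + 2 * i by ring, mul_assoc (e _), ← mul_assoc (rows e _ _ _),
    ← hcomm.eq, mul_assoc (e _), ← mul_assoc, hv, zero_mul]

end TLRel

/-! ### Crossings -/

theorem skein_slide {R B : Type*} [CommRing R] [Ring B] [Algebra R B] {a b : B} {s r d : R}
    (hrs : r * s = 1) (hd : d = -(s ^ 2 + r ^ 2)) (ha : a * a = d • a) (hb : b * b = d • b)
    (hab : a * b * a = a) (hba : b * a * b = b) :
    (s • (1 : B) + r • b) * (s • (1 : B) + r • a) * b =
      a * ((s • (1 : B) + r • b) * (s • (1 : B) + r • a)) := by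
  have hcancel : s * s + r * s * d + r * r = 0 := by rw [hrs, hd]; ring
  trans a * b
  · trans (s * s + (r * s) * d + r * r) • b + (r * s) • (a * b)
    · simp only [add_mul, mul_add, smul_mul_assoc, mul_smul_comm, one_mul, mul_one, hb, hba,
        smul_smul, smul_add]
      module
    · rw [hcancel, zero_smul, hrs, one_smul, zero_add]
  · trans (s * s + (r * s) * d + r * r) • a + (r * s) • (a * b)
    · rw [hcancel, zero_smul, hrs, one_smul, zero_add]
    · simp only [add_mul, mul_add, smul_mul_assoc, mul_smul_comm, one_mul, mul_one, ← mul_assoc,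
        ha, hab, smul_smul, smul_add]
      module

section Crossing

variable {A : Type*} [Ring A] [Algebra K A]

/-- The crossing of the strands `i` and `i + 1`, resolved by the Kauffman bracket. -/
def sig (e : ℕ → A) (i : ℕ) : A := t • (1 : A) + t⁻¹ • e i

/-- The crossing of `l` strands, entering below, under `n` strands entering above them. -/
def bundle (e : ℕ → A) (n : ℕ) : ℕ → A
  | 0 => 1
  | l + 1 => bundle e n l * desc (sig e) l n

variable {N : ℕ} {e : ℕ → A} {p k : ℕ} {u : A}

theorem commute_sig {x : A} {i : ℕ} (hx : Commute x (e i)) : Commute x (sig e i) :=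
  ((Commute.one_right x).smul_right _).add_right (hx.smul_right _)

theorem desc_sig_mul_of_annihilates (hu : ∀ m, p ≤ m → m < p + k → e m * u = 0) :
    desc (sig e) p k * u = t ^ k • u := by
  induction k with
  | zero => rw [desc, one_mul, pow_zero, one_smul]
  | succ k ih =>
    rw [desc, mul_assoc, ih fun m hpm hm => hu m hpm (by omega), mul_smul_comm, sig, add_mul,
      smul_mul_assoc, smul_mul_assoc, hu _ (by omega) (by omega), one_mul, smul_zero, add_zero,
      smul_smul, pow_succ]

theorem mul_desc_sig_of_annihilates (hu : ∀ m, p ≤ m → m < p + k → u * e m = 0) :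
    u * desc (sig e) p k = t ^ k • u := by
  induction k with
  | zero => rw [desc, mul_one, pow_zero, one_smul]
  | succ k ih =>
    rw [desc, ← mul_assoc, sig, mul_add, mul_smul_comm, mul_smul_comm, hu _ (by omega) (by omega),
      mul_one, smul_zero, add_zero, smul_mul_assoc, ih fun m hpm hm => hu m hpm (by omega),
      smul_smul, pow_succ']

namespace TLRel

section Commute

variable {δ : K} (h : TLRel δ N e)

include h

theorem commute_bundle {n l m : ℕ} (hm : n + l ≤ m) : Commute (e m) (bundle e n l) := by
  induction l with
  | zero => exact Commute.one_right _
  | succ l ih =>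
    exact (ih (by omega)).mul_right
      (commute_desc fun i _ hi => commute_sig (h.commute _ _ (by omega)).symm)

theorem mul_desc_sig {L : ℕ} (hu : ∀ m, p ≤ m → m + 1 < p + L → u * e m = 0) :
    u * desc (sig e) p L = ∑ x ∈ antidiagonal L,
      t ^ ((x.1 : ℤ) - x.2) • (u * desc e (p + x.1) x.2) := by
  induction L generalizing u with
  | zero => simp [desc]
  | succ L ih =>
    have hresolved : u * e (p + L) * desc (sig e) p L = _ := ih (u := u * e (p + L)) (by
      intro m hpm hm
      rw [mul_assoc, ← (h.commute m (p + L) (by omega)).eq, ← mul_assoc, hu m hpm (by omega),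
        zero_mul])
    have hthrough : u * desc (sig e) p L = t ^ L • u :=
      mul_desc_sig_of_annihilates fun m hpm hm => hu m hpm (by omega)
    rw [desc, ← mul_assoc, sig, mul_add, add_mul, mul_smul_comm, mul_one, smul_mul_assoc, hthrough,
      mul_smul_comm, smul_mul_assoc, hresolved, Finset.smul_sum, Finset.Nat.sum_antidiagonal_succ']
    congr 1
    · rw [desc, mul_one, smul_smul, ← pow_succ', ← zpow_natCast]
      congr 1
    · refine Finset.sum_congr rfl fun x hx => ?_
      have hx : x.1 + x.2 = L := Finset.HasAntidiagonal.mem_antidiagonal.1 hx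
      rw [smul_smul, ← zpow_neg_one, ← zpow_add₀ t_ne_zero, desc, add_assoc p, hx, mul_assoc]
      congr 2
      push_cast
      ring

end Commute

variable (h : TLRel (-qInt 2) N e)

include h

theorem sig_slide {m : ℕ} (hm : m + 2 < N) :
    sig e (m + 1) * sig e m * e (m + 1) = e m * (sig e (m + 1) * sig e m) :=
  skein_slide (inv_mul_cancel₀ t_ne_zero) (by rw [qInt_two]) (h.mul_self m) (h.mul_self (m + 1))
    (h.mul_succ_mul m hm) (h.succ_mul_mul_succ m)

theorem desc_sig_slide {m : ℕ} (hp : p ≤ m) (hm : m + 2 ≤ p + k) (hN : m + 2 < N) :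
    desc (sig e) p k * e (m + 1) = e m * desc (sig e) p k := by
  obtain ⟨r, rfl⟩ := Nat.exists_eq_add_of_le hp
  obtain ⟨s, rfl⟩ := Nat.exists_eq_add_of_le (show r + 2 ≤ k by omega)
  have hlow : Commute (e (p + r + 1)) (desc (sig e) p r) :=
    commute_desc fun i _ hi => commute_sig (h.commute _ _ (by omega)).symm
  have hhigh : Commute (e (p + r)) (desc (sig e) (p + (r + 2)) s) :=
    commute_desc fun i hi _ => commute_sig (h.commute _ _ (by omega))
  have hsplit : desc (sig e) p (r + 2 + s) = desc (sig e) (p + (r + 2)) s *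
      (sig e (p + r + 1) * sig e (p + r)) * desc (sig e) p r := by
    simp only [desc_add, desc, ← add_assoc, mul_assoc]
  rw [hsplit, mul_assoc, ← hlow.eq, ← mul_assoc, mul_assoc (desc (sig e) _ s), h.sig_slide hN,
    ← mul_assoc (desc (sig e) _ s), ← hhigh.eq]
  simp only [mul_assoc]

theorem bundle_slide {n l m : ℕ} (hm : m + 2 ≤ n) (hN : l + n ≤ N) :
    bundle e n l * e (m + l) = e m * bundle e n l := by
  induction l with
  | zero => rw [bundle, one_mul, mul_one, add_zero]
  | succ l ih =>
    rw [bundle, mul_assoc, ← add_assoc, h.desc_sig_slide (by omega) (by omega) (by omega),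
      ← mul_assoc, ih (by omega), mul_assoc]

end TLRel

end Crossing

/-! ### Quantum binomial coefficients -/

theorem qPoch_zero : qPoch 0 = 1 := by
  rw [qPoch, Finset.Icc_eq_empty (by omega), Finset.prod_empty]

theorem qPoch_succ (k : ℕ) : qPoch (k + 1) = qPoch k * (1 - q ^ (k + 1)) := by
  rw [qPoch, Finset.prod_Icc_succ_top (by omega), qPoch]

theorem one_sub_q_pow_ne_zero {k : ℕ} (hk : k ≠ 0) : 1 - q ^ k ≠ 0 := by
  rw [sub_ne_zero, q, ← pow_mul]
  exact (t_pow_ne_one (by omega)).symm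

theorem qPoch_ne_zero (k : ℕ) : qPoch k ≠ 0 :=
  Finset.prod_ne_zero_iff.2 fun _ hl =>
    one_sub_q_pow_ne_zero (Nat.one_le_iff_ne_zero.1 (Finset.mem_Icc.1 hl).1)

theorem qBinom_add (j d : ℕ) : qBinom (j + d) d = qPoch (j + d) / (qPoch d * qPoch j) := by
  rw [qBinom, if_pos (by omega), Nat.add_sub_cancel]

theorem qBinom_zero (n : ℕ) : qBinom n 0 = 1 := by
  rw [← add_zero n, qBinom_add, qPoch_zero, one_mul, add_zero, div_self (qPoch_ne_zero n)]

theorem qBinom_self (n : ℕ) : qBinom n n = 1 := by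
  rw [qBinom, if_pos le_rfl, Nat.sub_self, qPoch_zero, mul_one, div_self (qPoch_ne_zero n)]

theorem qBinom_succ_add_succ (j d : ℕ) :
    qBinom (j + 1 + (d + 1)) (d + 1) =
      qBinom (j + 1 + d) d + q ^ (d + 1) * qBinom (j + (d + 1)) (d + 1) := by
  have hj := qPoch_ne_zero j
  have hd := qPoch_ne_zero d
  have hj' := one_sub_q_pow_ne_zero j.succ_ne_zero
  have hd' := one_sub_q_pow_ne_zero d.succ_ne_zero
  rw [qBinom_add, qBinom_add, qBinom_add, ← add_assoc (j + 1) d 1, qPoch_succ (j + 1 + d),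
    add_right_comm j 1 d, add_assoc j d 1, qPoch_succ j, qPoch_succ d]
  field_simp
  ring

/-- The coefficient, in the partial resolution of a crossing of two clasped bundles of `n` strands,
of the diagrams with `j` turnbacks and `d` through strands among the resolved ones. -/
def crossCoeff (n j d : ℕ) : K := t ^ ((n : ℤ) * (d - j) - 2 * j * d) * qBinom (j + d) d

theorem crossCoeff_zero_succ (n d : ℕ) :
    crossCoeff n 0 (d + 1) = crossCoeff n 0 d * t ^ ((n : ℤ) - 2 * (0 : ℕ)) := by
  rw [crossCoeff, crossCoeff, zero_add, zero_add, qBinom_self, qBinom_self, mul_one, mul_one,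
    ← zpow_add₀ t_ne_zero]
  congr 1
  push_cast
  ring

theorem crossCoeff_succ_zero (n j : ℕ) :
    crossCoeff n (j + 1) 0 = crossCoeff n j 0 * t ^ (2 * ((0 : ℕ) : ℤ) - n) := by
  rw [crossCoeff, crossCoeff, qBinom_zero, qBinom_zero, mul_one, mul_one, ← zpow_add₀ t_ne_zero]
  congr 1
  push_cast
  ring

theorem crossCoeff_succ_succ (n j d : ℕ) :
    crossCoeff n (j + 1) (d + 1) = crossCoeff n (j + 1) d * t ^ ((n : ℤ) - 2 * (j + 1 : ℕ)) +
      crossCoeff n j (d + 1) * t ^ (2 * ((d + 1 : ℕ) : ℤ) - n) := by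
  have hq : q ^ (d + 1) = t ^ (4 * ((d : ℤ) + 1)) := by
    rw [q, ← pow_mul, ← zpow_natCast]
    norm_cast
  rw [crossCoeff, crossCoeff, crossCoeff, qBinom_succ_add_succ, hq, mul_add, ← mul_assoc,
    mul_right_comm _ (qBinom _ _), mul_right_comm _ (qBinom _ _), ← zpow_add₀ t_ne_zero,
    ← zpow_add₀ t_ne_zero, ← zpow_add₀ t_ne_zero]
  congr 3 <;> push_cast <;> ring

theorem sum_antidiagonal_succ_of_pascal {R M : Type*} [Semiring R] [AddCommMonoid M] [Module R M]
    {c : ℕ → ℕ → R} {α β : ℕ → R} (hc₀ : ∀ d, c 0 (d + 1) = c 0 d * α 0)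
    (hc₁ : ∀ j, c (j + 1) 0 = c j 0 * β 0)
    (hc : ∀ j d, c (j + 1) (d + 1) = c (j + 1) d * α (j + 1) + c j (d + 1) * β (d + 1))
    (G : ℕ → ℕ → M) {s : ℕ} :
    ∑ x ∈ antidiagonal s,
        c x.1 x.2 • (α x.1 • G x.1 (x.2 + 1) + β x.2 • G (x.1 + 1) x.2) =
      ∑ x ∈ antidiagonal (s + 1), c x.1 x.2 • G x.1 x.2 := by
  simp only [smul_add, smul_smul, Finset.sum_add_distrib]
  obtain - | s := s
  · simp [Finset.Nat.antidiagonal_succ, hc₀, hc₁]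
  · rw [Finset.Nat.sum_antidiagonal_succ (n := s + 1), Finset.Nat.sum_antidiagonal_succ,
      Finset.Nat.sum_antidiagonal_succ', Finset.Nat.sum_antidiagonal_succ']
    simp only [hc₀, hc₁, hc, add_smul, Finset.sum_add_distrib]
    abel

/-! ### The crossing of two clasped bundles -/

section ClaspedCrossing

variable {A : Type*} [Ring A] [Algebra K A] {N n : ℕ} {e : ℕ → A} {f : A}

/-- `f` annihilates turnbacks on both sides within each of two groups of `n` strands. The generator
`e (n - 1)` joins the two groups and is exempt. -/
structure AnnihilatesOffCenter (e : ℕ → A) (n : ℕ) (f : A) : Prop where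
  gen_mul : ∀ m, m + 1 ≠ n → m + 2 ≤ 2 * n → e m * f = 0
  mul_gen : ∀ m, m + 1 ≠ n → m + 2 ≤ 2 * n → f * e m = 0

namespace TLRel

variable {δ : K}

theorem mul_desc_sig_mul_rows (h : TLRel δ N e) {p a j : ℕ} {v : A} (hN : p + a + j + 2 ≤ N)
    (hj : j ≤ a) (hv : ∀ m, p ≤ m → m ≤ p + a + j → m ≠ p + a → v * e m = 0)
    (hf : ∀ m, p + 2 * j < m → m ≤ p + a + j → e m * f = 0) :
    v * desc (sig e) p (a + 1) * (rows e (p + 1) (a + 1) j * f) =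
      t ^ ((a : ℤ) + 1 - 2 * j) • (v * (rows e (p + 1) a j * f)) +
      t ^ (-((a : ℤ) + 1)) • (v * (rows e p (a + 1) (j + 1) * f)) := by
  have hvanish : ∀ x ∈ antidiagonal a, x ≠ (a - j, j) →
      v * (desc e (p + 1 + x.1) x.2 * rows e (p + 1) (a + 1) j) * f = 0 := by
    rintro ⟨r, i⟩ hx hne
    have hri : r + i = a := Finset.HasAntidiagonal.mem_antidiagonal.1 hx
    rcases lt_trichotomy i j with hij | rfl | hji
    · obtain ⟨k, rfl⟩ := Nat.exists_eq_add_of_lt hij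
      subst hri
      rw [add_assoc i k 1, h.mul_desc_mul_rows_eq_zero (by omega)
        (hv _ (by omega) (by omega) (by omega)), zero_mul]
    · cases hne (Prod.ext (Nat.eq_sub_of_add_eq hri) rfl)
    · obtain ⟨s, rfl⟩ := Nat.exists_eq_add_of_lt hji
      rw [← hri, ← add_assoc r, ← add_assoc r, add_assoc j s 1, mul_assoc v,
        h.desc_mul_rows_mul_eq_zero (by omega) (hf _ (by omega) (by omega)), mul_zero]
  have hmiddle : desc e (p + 1 + (a - j)) j * rows e (p + 1) (a + 1) j = rows e (p + 1) a j := by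
    simpa only [Nat.sub_add_cancel hj] using h.desc_mul_rows_self (p + 1) (a - j) j (by omega)
  rw [h.mul_desc_sig fun m hpm hm => hv m hpm (by omega) (by omega),
    Finset.Nat.sum_antidiagonal_succ, add_mul, Finset.sum_mul,
    Finset.sum_eq_single (a - j, j) ?_ ?_, add_comm]
  · rw [smul_mul_assoc, smul_mul_assoc, mul_assoc v, mul_assoc v, ← mul_assoc (desc e _ j),
      ← mul_assoc (desc e _ (a + 1)), ← add_assoc p, add_right_comm p, hmiddle, add_zero,
      ← rows_succ']
    congr 3
    push_cast [Nat.cast_sub hj]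
    ring
  · intro x hx hne
    have := hvanish x hx hne
    rw [smul_mul_assoc, ← mul_assoc, mul_assoc v, add_comm x.1, ← add_assoc, this, smul_zero]
  · exact fun hmem => absurd (Finset.HasAntidiagonal.mem_antidiagonal.2 (by omega)) hmem

end TLRel

variable (h : TLRel (-qInt 2) (2 * n) e) (hf : AnnihilatesOffCenter e n f)

include h hf

theorem TLRel.crossing_step {l j d : ℕ} (hn : n = l + 1 + (j + d)) :
    f * bundle e n (l + 1) * rows e (l + 1 + d) (l + 1 + j) j * f =
      t ^ ((n : ℤ) - 2 * j) • (f * bundle e n l * rows e (l + (d + 1)) (l + j) j * f) +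
      t ^ (2 * (d : ℤ) - n) •
        (f * bundle e n l * rows e (l + d) (l + (j + 1)) (j + 1) * f) := by
  have hv : ∀ m, l + d ≤ m → m ≤ l + d + (l + j) + j → m ≠ l + d + (l + j) →
      f * bundle e n l * e m = 0 := by
    intro m hlow hhigh hne
    rcases lt_or_ge m (n + l) with hm | hm
    · obtain ⟨m, rfl⟩ := Nat.exists_eq_add_of_le' (show l ≤ m by omega)
      rw [mul_assoc, h.bundle_slide (by omega) (by omega), ← mul_assoc,
        hf.mul_gen _ (by omega) (by omega), zero_mul]
    · rw [mul_assoc, ← (h.commute_bundle hm).eq, ← mul_assoc, hf.mul_gen _ (by omega) (by omega),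
        zero_mul]
  have hthrough : desc (sig e) l d * (rows e (l + 1 + d) (l + 1 + j) j * f) =
      t ^ d • (rows e (l + 1 + d) (l + 1 + j) j * f) := by
    refine desc_sig_mul_of_annihilates fun m _ hhigh => ?_
    have hcomm : Commute (e m) (rows e (l + 1 + d) (l + 1 + j) j) :=
      commute_rows fun i hi _ => h.commute _ _ (by omega)
    rw [← mul_assoc, hcomm.eq, mul_assoc, hf.gen_mul _ (by omega) (by omega), mul_zero]
  have hstep := h.mul_desc_sig_mul_rows (a := l + j) (j := j) (f := f) (by omega) (by omega) hv
    fun m _ hhigh => hf.gen_mul m (by omega) (by omega)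
  have hsplit : desc (sig e) l n = desc (sig e) (l + d) (l + j + 1) * desc (sig e) l d := by
    rw [← desc_add, hn]
    congr 1
    ring
  rw [add_right_comm l d 1, add_right_comm l j 1] at hstep
  rw [bundle, hsplit, mul_assoc _ _ f, ← mul_assoc f, ← mul_assoc (f * _), mul_assoc _ _ (_ * f),
    hthrough, mul_smul_comm, add_right_comm l j 1, hstep, smul_add, smul_smul, smul_smul,
    ← zpow_natCast, ← zpow_add₀ t_ne_zero, ← zpow_add₀ t_ne_zero, hn]
  simp only [mul_assoc, ← add_assoc, add_right_comm l _ 1]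
  congr 3 <;> push_cast <;> ring

theorem TLRel.clasped_bundle_partial {s l : ℕ} (hn : n = l + s) :
    f * bundle e n n * f = ∑ x ∈ antidiagonal s, crossCoeff n x.1 x.2 •
      (f * bundle e n l * rows e (l + x.2) (l + x.1) x.1 * f) := by
  induction s generalizing l with
  | zero =>
    obtain rfl : n = l := hn
    simp [crossCoeff, qBinom_self, rows]
  | succ s ih =>
    rw [ih (l := l + 1) (by omega), ← sum_antidiagonal_succ_of_pascal
      (α := fun j => t ^ ((n : ℤ) - 2 * j)) (β := fun d => t ^ (2 * (d : ℤ) - n))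
      (crossCoeff_zero_succ n) (crossCoeff_succ_zero n) (crossCoeff_succ_succ n)
      fun j d => f * bundle e n l * rows e (l + d) (l + j) j * f]
    refine Finset.sum_congr rfl fun x hx => ?_
    have hx : x.1 + x.2 = s := Finset.HasAntidiagonal.mem_antidiagonal.1 hx
    rw [h.crossing_step hf (by omega)]

theorem TLRel.clasped_bundle :
    f * bundle e n n * f = ∑ x ∈ antidiagonal n,
      (t ^ (-(n : ℤ) ^ 2 + 2 * (x.2 : ℤ) ^ 2) * qBinom n x.2) • (f * rows e x.2 x.1 x.1 * f) := by
  rw [h.clasped_bundle_partial hf (zero_add n).symm]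
  refine Finset.sum_congr rfl fun x hx => ?_
  obtain rfl : x.1 + x.2 = n := Finset.HasAntidiagonal.mem_antidiagonal.1 hx
  rw [zero_add, zero_add, bundle, mul_one, crossCoeff]
  congr 3
  push_cast
  ring

end ClaspedCrossing

/-! ### The Temperley--Lieb algebra of webs -/

/-- The web space of a disk with `N` marked points on either side, as an algebra whose
multiplication is gluing side by side. -/
def TL (N : ℕ) : Type := W N N

namespace TL

variable {N : ℕ}

instance : AddCommGroup (TL N) := inferInstanceAs (AddCommGroup (W N N))

instance : Module K (TL N) := inferInstanceAs (Module K (W N N))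

/-- The element of the web space underlying an element of the Temperley--Lieb algebra. -/
def toW : TL N ≃ₗ[K] W N N := LinearEquiv.refl K (W N N)

instance : Ring (TL N) where
  __ := (inferInstance : AddCommGroup (TL N))
  mul x y := toW.symm (glue (toW x) (toW y))
  one := toW.symm (bracket (strands N))
  left_distrib x y z := (glue (toW x)).map_add (toW y) (toW z)
  right_distrib x y z := glue.map_add₂ (toW x) (toW y) (toW z)
  zero_mul x := glue.map_zero₂ (toW x)
  mul_zero x := (glue (toW x)).map_zero
  mul_assoc x y z := glue_assoc (toW x) (toW y) (toW z)
  one_mul x := glue_bracket_strands_left (toW x)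
  mul_one x := glue_bracket_strands_right (toW x)

theorem toW_mul (x y : TL N) : toW (x * y) = glue (toW x) (toW y) := rfl

theorem toW_one : toW (1 : TL N) = bracket (strands N) := rfl

instance : Algebra K (TL N) :=
  Algebra.ofModule (fun r x y => glue.map_smul₂ r (toW x) (toW y))
    (fun r x y => (glue (toW x)).map_smul r (toW y))

end TL

open TL

theorem place_comm {m n m' n' a b b₁ b₂ a₁ a₂ N M M' N' : ℕ} (hm : a + m + b₁ = N)
    (hn : a + n + b₁ = M) (hm' : a₁ + m' + b = M) (hn' : a₁ + n' + b = N') (km' : a₂ + m' + b = N)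
    (kn' : a₂ + n' + b = M') (km : a + m + b₂ = M') (kn : a + n + b₂ = N') (hgap : a + n ≤ a₁)
    (x : W m n) (y : W m' n') :
    glue (place a b₁ hm hn x) (place a₁ b hm' hn' y) =
      glue (place a₂ b km' kn' y) (place a b₂ km kn x) := by
  obtain ⟨g, rfl⟩ := Nat.exists_eq_add_of_le hgap
  obtain rfl : b₁ = g + (m' + b) := by omega
  obtain rfl : b₂ = g + (n' + b) := by omega
  obtain rfl : a₂ = a + m + g := by omega
  have hstack := (stack_eq_glue (place a g rfl rfl x) (place 0 b rfl rfl y)).symm.trans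
    (stack_eq_glue' _ _)
  have hplace := congrArg (place 0 0 (show _ = N by omega) (show _ = N' by omega)) hstack
  rw [place_glue (N' := M) 0 0 (by omega) (by omega) (by omega),
    place_glue (N' := M') 0 0 (by omega) (by omega) (by omega)] at hplace
  simpa only [place_place, zero_add, add_zero] using hplace

/-- The generator of the Temperley--Lieb algebra with turnbacks at the places `i` and `i + 1`. It is
`0` for `N < i + 2`, where there are no such places. -/
def gen (N i : ℕ) : TL N :=
  if h : i + 2 ≤ N then
    toW.symm (place i (N - i - 2) (by omega) (by omega) (glue (bracket .cap) (bracket .cup)))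
  else 0

theorem gen_of_lt {N i : ℕ} (h : N < i + 2) : gen N i = 0 :=
  dif_neg h.not_ge

section CapCup

variable {a b N M : ℕ}

theorem toW_gen (hm hn : a + 2 + b = N) :
    toW (gen N a) = place a b hm hn (glue (bracket .cap) (bracket .cup)) := by
  obtain rfl : b = N - a - 2 := by omega
  rw [gen, dif_pos (by omega), LinearEquiv.apply_symm_apply]

theorem glue_cap_cup (hN : a + 2 + b = N) (hM : a + 0 + b = M) :
    glue (place a b hN hM (bracket .cap)) (place a b hM hN (bracket .cup)) = toW (gen N a) := by
  rw [← place_glue, toW_gen]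

theorem glue_cup_cap_self (hN : a + 2 + b = N) (hM : a + 0 + b = M) :
    glue (place a b hM hN (bracket .cup)) (place a b hN hM (bracket .cap)) =
      (-qInt 2) • bracket (strands M) := by
  rw [← place_glue _ _ _ _ hM, glue_cup_cap, map_smul]
  exact congrArg _ (place_bracket_strands a b hM hM rfl)

theorem glue_cup_cap_succ (hN : a + 1 + 2 + b = N) (hM : a + 1 + 0 + b = M) :
    glue (place a (b + 1) (by omega) (by omega) (bracket .cup))
      (place (a + 1) b hN hM (bracket .cap)) = bracket (strands M) := by
  have h := congrArg (place a b (by omega) (by omega) : W 1 1 → W M M) glue_place_cup_place_cap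
  rw [place_glue (N' := N) _ _ _ (by omega), place_place, place_place, strands,
    place_bracket_strands] at h
  simpa only [strands, add_zero, add_comm 1 b, zero_add] using h

theorem glue_cup_succ_cap (hN : a + 1 + 2 + b = N) (hM : a + 1 + 0 + b = M) :
    glue (place (a + 1) b hM hN (bracket .cup))
      (place a (b + 1) (by omega) (by omega) (bracket .cap)) = bracket (strands M) := by
  have h := congrArg (place a b (by omega) (by omega) : W 1 1 → W M M) glue_place_cup_place_cap'
  rw [place_glue (N' := N) _ _ _ (by omega), place_place, place_place, strands,
    place_bracket_strands] at h
  simpa only [strands, add_zero, add_comm 1 b, zero_add] using h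

end CapCup

theorem tlRel_gen (N : ℕ) : TLRel (-qInt 2) N (gen N) where
  mul_self i := by
    rcases lt_or_ge N (i + 2) with hi | hi
    · rw [gen_of_lt hi, zero_mul, smul_zero]
    obtain ⟨b, hN⟩ := Nat.exists_eq_add_of_le hi
    refine toW.injective ?_
    rw [toW_mul, map_smul, ← glue_cap_cup hN.symm rfl, glue_assoc, ← glue_assoc (place i b rfl _ _),
      glue_cup_cap_self, map_smul, LinearMap.smul_apply, glue_bracket_strands_left, map_smul]
  commute i j hij := by
    rcases lt_or_ge N (j + 2) with hj | hj
    · rw [gen_of_lt hj]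
      exact Commute.zero_right _
    refine toW.injective ?_
    rw [toW_mul, toW_mul, toW_gen (a := i) (b := N - i - 2) (by omega) (by omega),
      toW_gen (a := j) (b := N - j - 2) (by omega) (by omega)]
    exact place_comm _ _ _ _ _ _ _ _ hij _ _
  succ_mul_mul_succ i := by
    rcases lt_or_ge N (i + 1 + 2) with hi | hi
    · rw [gen_of_lt hi, zero_mul, zero_mul]
    obtain ⟨b, hN⟩ := Nat.exists_eq_add_of_le hi
    refine toW.injective ?_
    rw [toW_mul, toW_mul, ← glue_cap_cup hN.symm rfl,
      ← glue_cap_cup (M := i + 1 + 0 + b) (a := i) (b := b + 1) (by omega) (by omega),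
      glue_assoc, glue_assoc, glue_assoc,
      ← glue_assoc (place (i + 1) b rfl _ _), glue_cup_succ_cap,
      glue_bracket_strands_left, ← glue_assoc (place i _ _ _ _), glue_cup_cap_succ,
      glue_bracket_strands_left]
  mul_succ_mul i hi := by
    obtain ⟨b, hN⟩ := Nat.exists_eq_add_of_le (show i + 1 + 2 ≤ N from hi)
    refine toW.injective ?_
    rw [toW_mul, toW_mul, ← glue_cap_cup hN.symm rfl,
      ← glue_cap_cup (M := i + 1 + 0 + b) (a := i) (b := b + 1) (by omega) (by omega),
      glue_assoc, glue_assoc, glue_assoc,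
      ← glue_assoc (place i (b + 1) _ _ _) (place (i + 1) b _ _ _), glue_cup_cap_succ,
      glue_bracket_strands_left, ← glue_assoc (place (i + 1) b _ _ _), glue_cup_succ_cap,
      glue_bracket_strands_left]

/-! ### Brackets as words in the generators -/

theorem bracket_hcomp {a b c : ℕ} (D : Tangle a b) (E : Tangle b c) :
    bracket (D.hcomp E) = glue (bracket D) (bracket E) := rfl

theorem bracket_vcomp {m n m' n' : ℕ} (D : Tangle m n) (E : Tangle m' n') :
    bracket (D.vcomp E) = stack (bracket D) (bracket E) := rfl

theorem bracket_overDown : bracket .overDown =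
    t • bracket (strands 2) + t⁻¹ • glue (bracket .cap) (bracket .cup) := by
  have hturn : Finsupp.single turnWeb 1 = stack (bracket .cap) (bracket .cup) := by
    rw [bracket, bracket, stack_single, mul_one, turnWeb]
  rw [stack_eq_glue, place_zero_zero, place_zero_zero] at hturn
  rw [← hturn]
  rfl

section Place

variable {a b N : ℕ}

theorem place_overDown (hm hn : a + 2 + b = N) :
    place a b hm hn (bracket .overDown) = toW (sig (gen N) a) := by
  rw [bracket_overDown, map_add, map_smul, map_smul, ← toW_gen hm hn, strands,
    place_bracket_strands, sig, map_add, map_smul, map_smul, toW_one,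
    strands]

theorem place_crossOne (k : ℕ) (hm : a + (k + 1) + b = N) (hn : a + (1 + k) + b = N) :
    place a b hm hn (bracket (crossOne k)) = toW (desc (sig (gen N)) a k) := by
  induction k generalizing b with
  | zero => exact place_bracket_strands a b hm hn rfl
  | succ k ih =>
    rw [crossOne, bracket_hcomp, bracket_vcomp, bracket_vcomp, stack_bracket_strands_left,
      stack_bracket_strands_right, place_glue (N' := N) a b hm (by omega) (by omega), place_place,
      place_place, place_overDown, desc, toW_mul, ← ih (b := 1 + b) (by omega) (by omega)]
    rfl

theorem place_cross (n l : ℕ) (hm : 0 + (n + l) + b = N) (hn : 0 + (l + n) + b = N) :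
    place 0 b hm hn (bracket (cross n l)) = toW (bundle (gen N) n l) := by
  induction l generalizing b with
  | zero => exact place_bracket_strands 0 b hm hn (by omega)
  | succ l ih =>
    rw [cross, bracket_hcomp, glue_eq_place_of_bracket_strands, place_place, bracket_hcomp,
      bracket_vcomp, bracket_vcomp, stack_bracket_strands_left, stack_bracket_strands_right,
      place_glue (N' := N) _ _ (by omega) (by omega) (by omega), place_place, place_place, bundle,
      toW_mul, ← ih (b := 1 + b) (by omega) (by omega),
      ← place_crossOne (b := b) n (by omega) (by omega)]
    simp only [add_zero, zero_add]

theorem place_clasp : ∀ (k : ℕ) {b : ℕ} (hm hn : a + k + b = N),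
    place a b hm hn (clasp k) = toW (jw (fun i => gen N (a + i)) k)
  | 0, b, hm, hn | 1, b, hm, hn => place_bracket_strands a b hm hn rfl
  | k + 2, b, hm, hn => by
    rw [clasp, map_add, map_smul, place_glue a b hm hm hn, place_glue a b hm hm hm, bracket_vcomp,
      bracket_hcomp, stack_bracket_strands_left, stack_bracket_strands_right, place_place,
      place_place, ← toW_gen]
    simp only [add_zero]
    rw [place_clasp (k + 1)]
    rfl

end Place

/-! ### Turnbacks -/

section Turnbacks

variable {a b a' b' N M : ℕ}

theorem gen_glue_cup_of_le {i : ℕ} (hM : a + 0 + b = M) (hN : a + 2 + b = N) (hi : a ≤ i) :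
    glue (toW (gen M i)) (place a b hM hN (bracket .cup)) =
      glue (place a b hM hN (bracket .cup)) (toW (gen N (i + 2))) := by
  rcases lt_or_ge M (i + 2) with hlt | hge
  · rw [gen_of_lt hlt, gen_of_lt (by omega), map_zero, map_zero, LinearMap.zero_apply,
      map_zero, map_zero]
  · rw [toW_gen (a := i) (b := M - i - 2) (by omega) (by omega),
      toW_gen (a := i + 2) (b := M - i - 2) (by omega) (by omega)]
    exact (place_comm _ _ _ _ _ _ _ _ (by omega) _ _).symm

theorem cup_glue_gen_of_lt {i : ℕ} (hM : a + 0 + b = M) (hN : a + 2 + b = N) (hi : i + 2 ≤ a) :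
    glue (place a b hM hN (bracket .cup)) (toW (gen N i)) =
      glue (toW (gen M i)) (place a b hM hN (bracket .cup)) := by
  rw [toW_gen (N := N) (b := N - i - 2) (by omega) (by omega),
    toW_gen (N := M) (b := M - i - 2) (by omega) (by omega)]
  exact (place_comm _ _ _ _ _ _ _ _ (by omega) _ _).symm

theorem cup_succ_glue_gen (hM : a + 1 + 0 + b = M) (hN : a + 1 + 2 + b = N) :
    glue (place (a + 1) b hM hN (bracket .cup)) (toW (gen N a)) =
      place a (b + 1) (by omega) (by omega) (bracket .cup) := by
  rw [← glue_cap_cup (M := M) (b := b + 1) (by omega) (by omega), ← glue_assoc, glue_cup_succ_cap,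
    glue_bracket_strands_left]

theorem cup_glue_gen_succ (hM : a + 1 + 0 + b = M) (hN : a + 1 + 2 + b = N) :
    glue (place a (b + 1) (by omega) (by omega) (bracket .cup)) (toW (gen N (a + 1))) =
      place (a + 1) b hM hN (bracket .cup) := by
  rw [← glue_cap_cup hN hM, ← glue_assoc, glue_cup_cap_succ, glue_bracket_strands_left]

theorem cap_glue_cup (s : ℕ) (ha : a' = a + s) (hN' : a' + 2 + b' = N) (hM' : a' + 0 + b' = M)
    (hM : a + 0 + b = M) (hN : a + 2 + b = N) :
    glue (place a' b' hN' hM' (bracket .cap)) (place a b hM hN (bracket .cup)) =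
      toW (desc (gen N) a (s + 1)) := by
  induction s generalizing a b with
  | zero =>
    obtain ⟨rfl, rfl⟩ : a' = a ∧ b' = b := by omega
    rw [glue_cap_cup, desc_one]
  | succ s ih =>
    obtain ⟨b, rfl⟩ : ∃ c, b = c + 1 := ⟨b - 1, by omega⟩
    rw [← cup_succ_glue_gen (b := b) (by omega) (by omega), ← glue_assoc,
      ih (a := a + 1) (b := b) (by omega) (by omega) (by omega), ← toW_mul, ← desc_succ']

theorem desc_glue_cup_succ (k : ℕ) (hM : a + 1 + 0 + b = M) (hN : a + 1 + 2 + b = N) :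
    glue (toW (desc (gen M) a k)) (place (a + 1) b hM hN (bracket .cup)) =
      glue (place a (b + 1) (by omega) (by omega) (bracket .cup))
        (toW (desc (gen N) (a + 1) (k + 1))) := by
  induction k with
  | zero => rw [desc_one, cup_glue_gen_succ hM hN, desc, toW_one, glue_bracket_strands_left]
  | succ k ih =>
    have hdesc : desc (gen N) (a + 1) (k + 1 + 1) =
        gen N (a + k + 2) * desc (gen N) (a + 1) (k + 1) := by
      rw [desc, show a + 1 + (k + 1) = a + k + 2 by ring]
    rw [desc, toW_mul, glue_assoc, ih, ← glue_assoc, gen_glue_cup_of_le _ _ (by omega), glue_assoc,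
      ← toW_mul, hdesc]

theorem cap_glue_rows_glue_cup (p l j : ℕ) (hN' : p + l + 2 + b' = N) (hM' : p + l + 0 + b' = M)
    (hM : p + j + 0 + b = M) (hN : p + j + 2 + b = N) :
    glue (glue (place (p + l) b' hN' hM' (bracket .cap)) (toW (rows (gen M) p l j)))
      (place (p + j) b hM hN (bracket .cup)) = toW (rows (gen N) p (l + 1) (j + 1)) := by
  induction j generalizing b with
  | zero =>
    rw [rows, toW_one, glue_bracket_strands_right, rows_one]
    exact cap_glue_cup l rfl hN' hM' hM hN
  | succ j ih =>
    have hslide : glue (toW (desc (gen M) (p + j) l))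
        (place (p + (j + 1)) b hM hN (bracket .cup)) = _ :=
      desc_glue_cup_succ (a := p + j) l hM hN
    rw [rows, toW_mul, ← glue_assoc, glue_assoc _ _ (place _ _ _ _ _), hslide, ← glue_assoc, ih,
      ← toW_mul]
    rfl

theorem bracket_caps_succ (j : ℕ) : bracket (caps (j + 1)) =
    glue (place j j (by omega) (by omega) (bracket .cap)) (bracket (caps j)) := by
  rw [caps, bracket_hcomp, bracket_hcomp, ← glue_assoc, glue_bracket_strands_eq_place,
    bracket_vcomp, bracket_vcomp, ← place_eq_stack, place_place]
  simp only [zero_add, add_zero]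

theorem bracket_cups_succ (j : ℕ) : bracket (cups (j + 1)) =
    glue (bracket (cups j)) (place j j (by omega) (by omega) (bracket .cup)) := by
  rw [cups, bracket_hcomp, bracket_hcomp, glue_assoc, glue_eq_place_of_bracket_strands,
    bracket_vcomp, bracket_vcomp, ← place_eq_stack, place_place]
  simp only [zero_add, add_zero]

theorem place_caps_cups (j : ℕ) (hm hn : a + (j + j) + b = N) :
    place a b hm hn (glue (bracket (caps j)) (bracket (cups j))) = toW (rows (gen N) a j j) := by
  induction j generalizing N with
  | zero =>
    rw [caps, cups, ← strands, glue_bracket_strands_left, strands, place_bracket_strands]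
    rfl
  | succ j ih =>
    rw [bracket_caps_succ, bracket_cups_succ, glue_assoc, ← glue_assoc (bracket (caps j)),
      place_glue (N' := a + (j + j) + b) a b hm rfl hn, place_glue a b rfl rfl hn, ih, place_place,
      place_place, ← glue_assoc, cap_glue_rows_glue_cup]

theorem bracket_turnback (n : ℕ) (k : Fin (n + 1)) :
    bracket (turnback n k) = toW (rows (gen (n + n)) k (n - k) (n - k)) := by
  rw [turnback, bracket_hcomp, glue_eq_place_of_bracket_strands, bracket_hcomp,
    glue_bracket_strands_eq_place, bracket_vcomp, bracket_vcomp, bracket_hcomp, ← place_eq_stack,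
    place_place, place_place]
  simp only [zero_add, add_zero]
  exact place_caps_cups _ _ _

end Turnbacks

/-! ### The crossing of two clasped bundles of webs -/

/-- Two clasps on `n` strands each, one above the other. -/
def twoClasps (n : ℕ) : TL (n + n) :=
  jw (gen (n + n)) n * jw (fun i => gen (n + n) (n + i)) n

theorem toW_twoClasps (n : ℕ) : toW (twoClasps n) = stack (clasp n) (clasp n) := by
  rw [stack_eq_glue, place_clasp, place_clasp, ← toW_mul]
  simp only [zero_add, twoClasps]

theorem annihilatesOffCenter_twoClasps (n : ℕ) :
    AnnihilatesOffCenter (gen (n + n)) n (twoClasps n) where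
  gen_mul m hne hm := by
    have h := tlRel_gen (n + n)
    rcases lt_or_gt_of_ne hne with hlt | hgt
    · rw [twoClasps, ← mul_assoc, h.gen_mul_jw (by omega), zero_mul]
    · obtain ⟨i, rfl⟩ := Nat.exists_eq_add_of_le (show n ≤ m by omega)
      rw [twoClasps, ← mul_assoc, (h.commute_gen_jw (by omega)).eq, mul_assoc,
        (h.shift n).gen_mul_jw (m := i) (by omega), mul_zero]
  mul_gen m hne hm := by
    have h := tlRel_gen (n + n)
    rcases lt_or_gt_of_ne hne with hlt | hgt
    · have hcomm : Commute (gen (n + n) m) (jw (fun i => gen (n + n) (n + i)) n) :=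
        commute_jw fun i _ => h.commute _ _ (by omega)
      rw [twoClasps, mul_assoc, ← hcomm.eq, ← mul_assoc, h.jw_mul_gen (by omega), zero_mul]
    · obtain ⟨i, rfl⟩ := Nat.exists_eq_add_of_le (show n ≤ m by omega)
      rw [twoClasps, mul_assoc, (h.shift n).jw_mul_gen (by omega), mul_zero]

theorem clasped_eq_toW {n : ℕ} {D : Tangle (n + n) (n + n)} {x : TL (n + n)}
    (h : bracket D = toW x) : clasped n D = toW (twoClasps n * x * twoClasps n) := by
  rw [clasped, h, ← toW_twoClasps, toW_mul, toW_mul]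

theorem bracket_cross (n : ℕ) : bracket (cross n n) = toW (bundle (gen (n + n)) n n) := by
  rw [← place_cross n n (b := 0) (by omega) (by omega), place_zero_zero]

theorem clasped_cross (n : ℕ) : clasped n (cross n n) = ∑ k : Fin (n + 1),
    (t ^ (-(n : ℤ) ^ 2 + 2 * ((k : ℕ) : ℤ) ^ 2) * qBinom n k) • clasped n (turnback n k) := by
  have hrel : TLRel (-qInt 2) (2 * n) (gen (n + n)) := two_mul n ▸ tlRel_gen (n + n)
  rw [clasped_eq_toW (bracket_cross n), hrel.clasped_bundle (annihilatesOffCenter_twoClasps n),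
    ← Finset.Nat.sum_antidiagonal_swap, Finset.Nat.sum_antidiagonal_eq_sum_range_succ_mk,
    Finset.sum_range, map_sum]
  exact Finset.sum_congr rfl fun k _ => by
    rw [map_smul, clasped_eq_toW (bracket_turnback n k), Prod.fst_swap, Prod.snd_swap]

/-! ### The colored loop -/

section ColoredLoop

variable {a b N M : ℕ} (hN : a + 2 + b = N) (hM : a + 0 + b = M)

theorem cup_glue_jw : ∀ {k : ℕ}, k ≤ a →
    glue (place a b hM hN (bracket .cup)) (toW (jw (gen N) k)) =
      glue (toW (jw (gen M) k)) (place a b hM hN (bracket .cup))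
  | 0, _ | 1, _ => (glue_bracket_strands_right _).trans (glue_bracket_strands_left _).symm
  | k + 2, hk => by
    have ih : glue (place a b hM hN (bracket .cup)) (toW (jw (gen N) (k + 1))) = _ :=
      cup_glue_jw (by omega)
    simp only [jw_add_two, map_add, map_smul, LinearMap.add_apply, LinearMap.smul_apply, ih]
    rw [toW_mul, toW_mul, ← glue_assoc, ← glue_assoc, ih, glue_assoc _ _ (toW (gen N k)),
      cup_glue_gen_of_lt hM hN hk, ← glue_assoc, glue_assoc _ _ (toW (jw (gen N) _)), ih,
      ← glue_assoc, ← toW_mul, ← toW_mul]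

theorem eq_of_cap_glue_glue_cup_eq {x y : W M M}
    (h : glue (place a b hN hM (bracket .cap)) (glue x (place a b hM hN (bracket .cup))) =
      glue (place a b hN hM (bracket .cap)) (glue y (place a b hM hN (bracket .cup)))) : x = y := by
  have hδ : -qInt 2 ≠ 0 := neg_ne_zero.2 (qInt_ne_zero two_ne_zero)
  have close (z : W M M) :
      glue (glue (place a b hM hN (bracket .cup)) (glue (place a b hN hM (bracket .cap))
        (glue z (place a b hM hN (bracket .cup))))) (place a b hN hM (bracket .cap)) =
        (-qInt 2 * -qInt 2) • z := by
    rw [← glue_assoc (place a b hM hN _), glue_cup_cap_self, map_smul, LinearMap.smul_apply,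
      glue_bracket_strands_left, map_smul, LinearMap.smul_apply, glue_assoc, glue_cup_cap_self,
      map_smul, glue_bracket_strands_right, smul_smul]
  refine smul_right_injective _ (mul_ne_zero hδ hδ) ?_
  simp only [← close, h]

theorem cup_glue_jw_succ_glue_cap :
    glue (place a b hM hN (bracket .cup))
      (glue (toW (jw (gen N) (a + 1))) (place a b hN hM (bracket .cap))) =
      (-(qInt (a + 2) / qInt (a + 1))) • toW (jw (gen M) a) := by
  refine eq_of_cap_glue_glue_cup_eq hN hM ?_
  have h := congrArg toW ((tlRel_gen N).gen_mul_jw_mul_gen a)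
  rw [← ((tlRel_gen N).commute_gen_jw le_rfl).eq, map_smul, toW_mul, toW_mul, toW_mul,
    ← glue_cap_cup hN hM] at h
  simpa only [glue_assoc, map_smul, LinearMap.smul_apply, cup_glue_jw hN hM le_rfl] using h

end ColoredLoop

theorem coloredLoop_eq (n : ℕ) : coloredLoop n =
    glue (glue (bracket (cups n)) (toW (jw (gen (n + n)) n))) (bracket (caps n)) := by
  rw [coloredLoop, stack_bracket_strands_right, place_clasp]
  simp only [zero_add]

theorem coloredLoop_succ (n : ℕ) :
    coloredLoop (n + 1) = (-(qInt (n + 2) / qInt (n + 1))) • coloredLoop n := by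
  rw [coloredLoop_eq, bracket_caps_succ, bracket_cups_succ, ← glue_assoc,
    glue_assoc (bracket (cups n)), glue_assoc (bracket (cups n)), glue_assoc (place _ _ _ _ _),
    cup_glue_jw_succ_glue_cap, map_smul, map_smul, LinearMap.smul_apply, ← coloredLoop_eq]

theorem coloredLoop_eq_smul (n : ℕ) :
    coloredLoop n = ((-1) ^ n * qInt ((n : ℤ) + 1)) • emptyDisk := by
  induction n with
  | zero =>
    have hone : coloredLoop 0 =
        glue (glue (bracket (strands 0)) (bracket (strands 0))) (bracket (strands 0)) := by
      rw [coloredLoop_eq]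
      rfl
    rw [hone, glue_bracket_strands_left, glue_bracket_strands_left, pow_zero, Nat.cast_zero,
      zero_add, qInt_one, one_mul, one_smul]
    rfl
  | succ n ih =>
    have hn : qInt ((n : ℤ) + 1) ≠ 0 := qInt_ne_zero (by omega)
    rw [coloredLoop_succ, ih, smul_smul, Nat.cast_succ, add_assoc (n : ℤ) 1 1, one_add_one_eq_two]
    congr 1
    field_simp
    ring

end A1Web

end

theorem mainTheorem8 (n : ℕ) :
    (A1Web.clasped n (A1Web.cross n n) =
      ∑ k : Fin (n + 1),
        (A1Web.t ^ (-(n : ℤ) ^ 2 + 2 * ((k : ℕ) : ℤ) ^ 2) * A1Web.qBinom n k) •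
          A1Web.clasped n (A1Web.turnback n k)) ∧
    A1Web.coloredLoop n = ((-1) ^ n * A1Web.qInt ((n : ℤ) + 1)) • A1Web.emptyDisk :=
  ⟨A1Web.clasped_cross n, A1Web.coloredLoop_eq_smul n⟩
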